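/- **Setting.** Let $\Sigma\in\mathbb R^{d\times d}$ be positive definite, $\theta\in\mathbb R^d$ and $\sigma\ge 0$. There are $m$ agents. Agent $i$ has a permutation matrix $\Pi_i=\begin{bmatrix}\Pi_{i+}\\ \Pi_{i-}\end{bmatrix}\in\mathbb R^{d\times d}$ with $\Pi_{i+}\in\mathbb R^{d_i\times d}$ (observed features) and $\Pi_{i-}\in\mathbb R^{(d-d_i)\times d}$ (unobserved features), and every one of the $d$ features is observed by at least one agent. Write $v_{i\pm}=\Pi_{i\pm}v$ for $v \in\mathbb R^d$, and $\Sigma_{i+}=\Pi_{i+}\Sigma\Pi_{i+}^\top$, $\Sigma_{i-}=\Pi_{i-}\Sigma\Pi_{i-}^\top$, $\Sigma_{i\pm}=\Pi_{i+}\Sigma\Pi_{i-}^\top$, $\Sigma_{i\mp}=\Pi_{i-}\Sigma\Pi_{i+}^\top$ for the corresponding blocks. Let $$T_i=\begin{bmatrix} I_{d_i} & \Sigma_{i+}^{-1}\Sigma_{i\pm}\end{bmatrix}\Pi_i,\qquad \Gamma_{i-}=\Sigma_{i-}-\Sigma_{i\mp}\Sigma_{i+}^{-1}\Sigma_{i\pm},\qquad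 \|v\|^2_{A}=\langle v,Av\rangle .$$ Agent $i$ has $n$ samples: a feature matrix $X_i\in\mathbb R^{n\times d}$, of which it observes $X_{i+}=X_i\Pi_{i+}^\top$, and labels $y_i=X_i\theta+\xi_i$. The rows of $X_1,\dots,X_m$ are i.i.d. copies of a square-integrable random vector $x\in\mathbb R^d$ with mean $0$ and covariance $\Sigma$; the entries of the noise vectors $\xi_1,\dots,\xi_m$ are i.i.d. $\mathsf N(0,\sigma^2)$ and independent of the features. For $\alpha_1,\dots,\alpha_m>0$ the global imputation estimator is $$\hat\theta^{\text{imp-glb}}=\Big(\sum_{i=1}^m\alpha_iT_i^\top X_{i+}^\top X_{i+}T_i\Big)^{-1}\Big(\sum_{i=1}^m\alpha_iT_i^\top X_{i+}^\top y_i\Big)$$ (with any fixed convention, here the inverse being $0$, where the matrix is singular). With $z_{i+}=x_{i-}-\Sigma_{i\mp}\Sigma_{i+}^{-1}x_{i+}$ put $$Q_i=\mathbb E\big[x_{i+}\,\theta_{i-}^\top z_{i+}z_{i+}^\top\theta_{i-}\,x_{i+}^\top\big]+\sigma^2\Sigma_{i+},\qquad W_i^\star=\Sigma_{i+}Q_i^{-1}\Sigma_{i+},\qquad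 C^\star=\Big(\sum_{i=1}^mT_i^\top W_i^\star T_i\Big)^{-1},$$ $$C^{\text{imp-glb}}(\alpha_1,\dots,\alpha_m)=\Big(\sum_{i=1}^m\alpha_iT_i^\top\Sigma_{i+}T_i\Big)^{-1}\Big(\sum_{i=1}^m\alpha_i^2T_i^\top Q_iT_i\Big)\Big(\sum_{i=1}^m\alpha_iT_i^\top\Sigma_{i+}T_i\Big)^{-1}.$$ **Theorem.** 1. (Consistency.) For all $\alpha_1,\dots,\alpha_m>0$, $\hat\theta^{\text{imp-glb}}\to\theta$ in probability as $n\to\infty$. 2. (Asymptotic normality.) If $\mathbb E\big[\|x_{i+}\|^2(\theta_{i-}^\top z_{i+})^2\big]<\infty$ for every $i$ (so that the $Q_i$ exist), then for all $\alpha_1,\dots,\alpha_m>0$ the matrix $C^{\text{imp-glb}}(\alpha_1,\dots,\alpha_m)$ is positive semidefinite and $$\sqrt n\,\big(\hat\theta^{\text{imp-glb}}-\theta\big)\xrightarrow{d}\mathsf N\big(0,C^{\text{imp-glb}}(\alpha_1,\dots,\alpha_m)\big).$$ 3. (Gaussian features.) If $x\sim\mathsf N(0,\Sigma)$, then the moment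 condition in 2 holds for every $i$. If moreover $\|\theta_{i-}\|^2_{\Gamma_{i-}}+\sigma^2>0$ for every $i$ (for instance if $\sigma>0$), then in the positive semidefinite order $C^{\text{imp-glb}}(\alpha_1,\dots,\alpha_m)\succeq C^\star$ for all $\alpha_1,\dots,\alpha_m>0$, with equality when $\alpha_i=1/(\|\theta_{i-}\|^2_{\Gamma_{i-}}+\sigma^2)$ for every $i$. -/

import Mathlib

open MeasureTheory ProbabilityTheory Filter Topology
open scoped Matrix

noncomputable section

namespace Collab

/-! ### Views

A view of `d` features in which `p` features are observed and `q` are unobserved is a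
bijection `π : Fin p ⊕ Fin q ≃ Fin d`; it encodes the permutation matrix `Π = [Π₊; Π₋]`. -/

section View

variable {d p q : ℕ}

/-- `Π₊`, the rows of the permutation matrix that select the observed features. -/
def viewPlus (π : Fin p ⊕ Fin q ≃ Fin d) : Matrix (Fin p) (Fin d) ℝ :=
  (1 : Matrix (Fin d) (Fin d) ℝ).submatrix (fun a => π (Sum.inl a)) id

/-- `Π₋`, the rows of the permutation matrix that select the unobserved features. -/
def viewMinus (π : Fin p ⊕ Fin q ≃ Fin d) : Matrix (Fin q) (Fin d) ℝ :=
  (1 : Matrix (Fin d) (Fin d) ℝ).submatrix (fun b => π (Sum.inr b)) id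

/-- `A₊ = Π₊ A Π₊ᵀ`. -/
def blockPlus (π : Fin p ⊕ Fin q ≃ Fin d) (A : Matrix (Fin d) (Fin d) ℝ) :
    Matrix (Fin p) (Fin p) ℝ :=
  viewPlus π * A * (viewPlus π)ᵀ

/-- `A₋ = Π₋ A Π₋ᵀ`. -/
def blockMinus (π : Fin p ⊕ Fin q ≃ Fin d) (A : Matrix (Fin d) (Fin d) ℝ) :
    Matrix (Fin q) (Fin q) ℝ :=
  viewMinus π * A * (viewMinus π)ᵀ

/-- `A± = Π₊ A Π₋ᵀ`. -/
def blockPlusMinus (π : Fin p ⊕ Fin q ≃ Fin d) (A : Matrix (Fin d) (Fin d) ℝ) :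
    Matrix (Fin p) (Fin q) ℝ :=
  viewPlus π * A * (viewMinus π)ᵀ

/-- `A∓ = Π₋ A Π₊ᵀ`. -/
def blockMinusPlus (π : Fin p ⊕ Fin q ≃ Fin d) (A : Matrix (Fin d) (Fin d) ℝ) :
    Matrix (Fin q) (Fin p) ℝ :=
  viewMinus π * A * (viewPlus π)ᵀ

/-- The imputation matrix `T = [I  Σ₊⁻¹ Σ±] Π`. -/
def imputeMat (π : Fin p ⊕ Fin q ≃ Fin d) (S : Matrix (Fin d) (Fin d) ℝ) :
    Matrix (Fin p) (Fin d) ℝ :=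
  Matrix.fromCols (1 : Matrix (Fin p) (Fin p) ℝ) ((blockPlus π S)⁻¹ * blockPlusMinus π S) *
    Matrix.fromRows (viewPlus π) (viewMinus π)

/-- The Schur complement `Γ₋ = Σ₋ - Σ∓ Σ₊⁻¹ Σ±`. -/
def schurMinus (π : Fin p ⊕ Fin q ≃ Fin d) (S : Matrix (Fin d) (Fin d) ℝ) :
    Matrix (Fin q) (Fin q) ℝ :=
  blockMinus π S - blockMinusPlus π S * (blockPlus π S)⁻¹ * blockPlusMinus π S

/-- The squared seminorm `‖v‖²_A = ⟨v, A v⟩`. -/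
def quadForm {ι : Type*} [Fintype ι] (A : Matrix ι ι ℝ) (v : ι → ℝ) : ℝ :=
  v ⬝ᵥ (A *ᵥ v)

/-- `‖θ₋‖²_{Γ₋} + σ²`. -/
def residualVar (π : Fin p ⊕ Fin q ≃ Fin d) (S : Matrix (Fin d) (Fin d) ℝ) (σ : ℝ)
    (θ : EuclideanSpace ℝ (Fin d)) : ℝ :=
  quadForm (schurMinus π S) (viewMinus π *ᵥ θ) + σ ^ 2

/-- The residual `z = x₋ - Σ∓ Σ₊⁻¹ x₊` of the best linear prediction of `x₋` from `x₊`. -/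
def residual (π : Fin p ⊕ Fin q ≃ Fin d) (S : Matrix (Fin d) (Fin d) ℝ)
    (x : EuclideanSpace ℝ (Fin d)) : Fin q → ℝ :=
  viewMinus π *ᵥ x - (blockMinusPlus π S * (blockPlus π S)⁻¹) *ᵥ (viewPlus π *ᵥ x)

/-- `Q = E[x₊ (θ₋ᵀ z)(zᵀ θ₋) x₊ᵀ] + σ² Σ₊`, where `x` has law `P`. -/
def scoreCov (π : Fin p ⊕ Fin q ≃ Fin d) (S : Matrix (Fin d) (Fin d) ℝ) (σ : ℝ)
    (θ : EuclideanSpace ℝ (Fin d)) (P : Measure (EuclideanSpace ℝ (Fin d))) :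
    Matrix (Fin p) (Fin p) ℝ :=
  Matrix.of (fun a b => ∫ x : EuclideanSpace ℝ (Fin d), (viewPlus π *ᵥ x) a *
      ((viewMinus π *ᵥ θ) ⬝ᵥ residual π S x) ^ 2 * (viewPlus π *ᵥ x) b ∂P) +
    σ ^ 2 • blockPlus π S

/-- `E[‖x₊‖² (θ₋ᵀ z)²] < ∞`, that is, the expectation in `scoreCov` exists. -/
def HasScoreCov (π : Fin p ⊕ Fin q ≃ Fin d) (S : Matrix (Fin d) (Fin d) ℝ)
    (θ : EuclideanSpace ℝ (Fin d)) (P : Measure (EuclideanSpace ℝ (Fin d))) : Prop :=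
  Integrable (fun x : EuclideanSpace ℝ (Fin d) => ((viewPlus π *ᵥ x) ⬝ᵥ (viewPlus π *ᵥ x)) *
    ((viewMinus π *ᵥ θ) ⬝ᵥ residual π S x) ^ 2) P

/-- The weight matrix `W⋆ = Σ₊ Q⁻¹ Σ₊`. -/
def optWeight (π : Fin p ⊕ Fin q ≃ Fin d) (S : Matrix (Fin d) (Fin d) ℝ) (σ : ℝ)
    (θ : EuclideanSpace ℝ (Fin d)) (P : Measure (EuclideanSpace ℝ (Fin d))) :
    Matrix (Fin p) (Fin p) ℝ :=
  blockPlus π S * (scoreCov π S σ θ P)⁻¹ * blockPlus π S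

end View

/-! ### Several agents: agent `i` observes `r i` of the `d` features -/

section Agents

variable {m d : ℕ} {r : Fin m → ℕ}

/-- `C⋆ = (∑ᵢ Tᵢᵀ Wᵢ⋆ Tᵢ)⁻¹`. -/
def optCov (π : ∀ i, Fin (r i) ⊕ Fin (d - r i) ≃ Fin d) (S : Matrix (Fin d) (Fin d) ℝ) (σ : ℝ)
    (θ : EuclideanSpace ℝ (Fin d)) (P : Measure (EuclideanSpace ℝ (Fin d))) :
    Matrix (Fin d) (Fin d) ℝ :=
  (∑ i, (imputeMat (π i) S)ᵀ * optWeight (π i) S σ θ P * imputeMat (π i) S)⁻¹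

/-- `C^{imp-glb}(α) = (∑ᵢ αᵢ Tᵢᵀ Σᵢ₊ Tᵢ)⁻¹ (∑ᵢ αᵢ² Tᵢᵀ Qᵢ Tᵢ) (∑ᵢ αᵢ Tᵢᵀ Σᵢ₊ Tᵢ)⁻¹`. -/
def impGlbCov (π : ∀ i, Fin (r i) ⊕ Fin (d - r i) ≃ Fin d) (S : Matrix (Fin d) (Fin d) ℝ)
    (σ : ℝ) (θ : EuclideanSpace ℝ (Fin d)) (P : Measure (EuclideanSpace ℝ (Fin d)))
    (α : Fin m → ℝ) : Matrix (Fin d) (Fin d) ℝ :=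
  (∑ i, α i • ((imputeMat (π i) S)ᵀ * blockPlus (π i) S * imputeMat (π i) S))⁻¹ *
    (∑ i, α i ^ 2 • ((imputeMat (π i) S)ᵀ * scoreCov (π i) S σ θ P * imputeMat (π i) S)) *
    (∑ i, α i • ((imputeMat (π i) S)ᵀ * blockPlus (π i) S * imputeMat (π i) S))⁻¹

/-- The global imputation estimator
`(∑ᵢ αᵢ Tᵢᵀ Xᵢ₊ᵀ Xᵢ₊ Tᵢ)⁻¹ (∑ᵢ αᵢ Tᵢᵀ Xᵢ₊ᵀ yᵢ)`, a function of the observed features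
`Xᵢ₊` and the labels `yᵢ`. -/
def impGlb {n : ℕ} (T : ∀ i, Matrix (Fin (r i)) (Fin d) ℝ) (α : Fin m → ℝ)
    (X : ∀ i, Matrix (Fin n) (Fin (r i)) ℝ) (y : Fin m → Fin n → ℝ) :
    EuclideanSpace ℝ (Fin d) :=
  WithLp.toLp 2 ((∑ i, α i • ((T i)ᵀ * (X i)ᵀ * X i * T i))⁻¹ *ᵥ
    (∑ i, α i • (((T i)ᵀ * (X i)ᵀ) *ᵥ y i)))

/-- The matrix whose rows are the first `n` feature vectors of an infinite sample. -/
def designMat (n : ℕ) (x : ℕ → EuclideanSpace ℝ (Fin d)) : Matrix (Fin n) (Fin d) ℝ :=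
  Matrix.of fun k j => x k j

/-- The global imputation estimator of the linear model `yᵢ = Xᵢ θ + εᵢ` after `n` samples per
agent, where `x i k` and `ε i k` are the `k`-th feature vector and the `k`-th noise variable of
agent `i`. -/
def impGlbEstimator (π : ∀ i, Fin (r i) ⊕ Fin (d - r i) ≃ Fin d)
    (S : Matrix (Fin d) (Fin d) ℝ) (θ : EuclideanSpace ℝ (Fin d)) (α : Fin m → ℝ) (n : ℕ)
    (x : Fin m → ℕ → EuclideanSpace ℝ (Fin d)) (ε : Fin m → ℕ → ℝ) :
    EuclideanSpace ℝ (Fin d) :=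
  impGlb (fun i => imputeMat (π i) S) α
    (fun i => designMat n (x i) * (viewPlus (π i))ᵀ)
    (fun i => designMat n (x i) *ᵥ θ + fun k : Fin n => ε i k)

end Agents

end Collab

end

/-! For each agent let `g = residualDir` be the vector with `⟨θ₋, z⟩ = ⟨g, x⟩`. Then `θ = Π₊ᵀ T θ +
g`, so a label splits as `y = ⟨x₊, T θ⟩ + (⟨g, x⟩ + ξ)`: imputation is a regression on `Tᵀ x₊` with
the true parameter `θ` and the inflated noise `⟨g, x⟩ + ξ`. Hence the estimator solves `A θ̂ = A θ +
u`, where `A` and `u` are sums over samples of i.i.d. Gram matrices and scores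
(`impGlbEstimator_eq_linearSolve`).

The normal equations `Π₊ Σ g = 0` make the score centred. By the law of large numbers `A / n → H = ∑
αᵢ Tᵢᵀ Σᵢ₊ Tᵢ`, and `H` is positive definite because `Σ₊ T = Π₊ Σ` and every feature is observed
(`sum_smul_posDef`). Consistency follows from `u / n → 0`. Asymptotic normality follows from the
central limit theorem for `u / √n`, whose limiting covariance is `∑ αᵢ² Tᵢᵀ Qᵢ Tᵢ`, and Slutsky's
lemma (`tendstoInDistribution_linearSolve`).

For Gaussian features, `⟨g, x⟩` is not only uncorrelated with `x₊` but independent of it, so `Qᵢ =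
cᵢ Σᵢ₊` with the scalar `cᵢ = residualVar`. Optimality of `αᵢ = 1 / cᵢ` is then a Gauss–Markov
argument: the excess covariance is a sum of positive semidefinite matrices
(`sandwich_sub_posSemidef`). -/

/-! ### Independent families of random variables -/

/-- Independent variables indexed by pairs give independent families when curried. -/
theorem ProbabilityTheory.iIndepFun.curry {ι κ Ω α : Type*} [Countable ι] [Countable κ]
    [MeasurableSpace Ω] [MeasurableSpace α] {P : Measure Ω} {X : ι × κ → Ω → α}
    (mX : ∀ p, AEMeasurable (X p) P) (h : iIndepFun X P) :
    iIndepFun (fun i ω (j : κ) => X (i, j) ω) P := by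
  have := h.isProbabilityMeasure
  have hpr : ∀ p, IsProbabilityMeasure (P.map (X p)) :=
    fun p => Measure.isProbabilityMeasure_map (mX p)
  have hpr' : ∀ i j, IsProbabilityMeasure ((fun i j => P.map (X (i, j))) i j) :=
    fun i j => hpr (i, j)
  have hrow : ∀ i, AEMeasurable (fun ω (j : κ) => X (i, j) ω) P :=
    fun i => aemeasurable_pi_lambda _ fun j => mX (i, j)
  rw [iIndepFun_iff_map_fun_eq_infinitePi_map₀' hrow]
  have h1 : ∀ i, P.map (fun ω (j : κ) => X (i, j) ω)
      = Measure.infinitePi fun j => P.map (X (i, j)) := fun i =>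
    (h.precomp (g := fun j : κ => (i, j)) (Prod.mk_right_injective i)).map_fun_eq_infinitePi_map₀'
      fun j => mX (i, j)
  simp_rw [h1]
  -- Independence is the statement that the joint law is a product measure, and currying carries the
  -- product over pairs to the product of the row products.
  rw [← Measure.infinitePi_map_curry (fun i j => P.map (X (i, j))),
    ← h.map_fun_eq_infinitePi_map₀' mX,
    AEMeasurable.map_map_of_aemeasurable (by fun_prop) (aemeasurable_pi_lambda _ mX)]
  rfl

/-- Independent families with pairwise identically distributed members are identically
distributed. -/
theorem ProbabilityTheory.iIndepFun.identDistrib_pi {ι Ω α : Type*} [Countable ι]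
    [MeasurableSpace Ω] [MeasurableSpace α] {P : Measure Ω} {X Y : ι → Ω → α}
    (hX : iIndepFun X P) (hY : iIndepFun Y P) (hXY : ∀ i, IdentDistrib (X i) (Y i) P P) :
    IdentDistrib (fun ω i => X i ω) (fun ω i => Y i ω) P P where
  aemeasurable_fst := aemeasurable_pi_lambda _ fun i => (hXY i).aemeasurable_fst
  aemeasurable_snd := aemeasurable_pi_lambda _ fun i => (hXY i).aemeasurable_snd
  map_eq := by
    rw [hX.map_fun_eq_infinitePi_map₀' fun i => (hXY i).aemeasurable_fst,
      hY.map_fun_eq_infinitePi_map₀' fun i => (hXY i).aemeasurable_snd]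
    simp_rw [(hXY _).map_eq]

/-! ### Second moments and the multivariate central limit theorem -/

namespace Collab

variable {d : ℕ}

/-- The second moment matrix of a square-integrable random vector is positive semidefinite. -/
theorem posSemidef_of_second_moment {Ω : Type*} [MeasurableSpace Ω] {μ : Measure Ω}
    {X : Ω → EuclideanSpace ℝ (Fin d)} {M : Matrix (Fin d) (Fin d) ℝ}
    (hX : ∀ j, MemLp (fun ω => X ω j) 2 μ)
    (hM : ∀ j l, ∫ ω, X ω j * X ω l ∂μ = M j l) (t : Fin d → ℝ) :
    ∫ ω, (∑ j, t j * X ω j) ^ 2 ∂μ = t ⬝ᵥ M *ᵥ t ∧ M.PosSemidef := by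
  have key : ∀ t : Fin d → ℝ, ∫ ω, (∑ j, t j * X ω j) ^ 2 ∂μ = t ⬝ᵥ M *ᵥ t := by
    intro t
    simp_rw [sq, Finset.sum_mul_sum]
    have hint : ∀ j l, Integrable (fun ω => t j * X ω j * (t l * X ω l)) μ := fun j l =>
      ((hX j).const_mul (t j)).integrable_mul ((hX l).const_mul (t l))
    rw [integral_finsetSum _ fun j _ => integrable_finsetSum _ fun l _ => hint j l]
    simp_rw [integral_finsetSum _ fun l _ => hint _ l, dotProduct, Matrix.mulVec, dotProduct,
      Finset.mul_sum]
    refine Finset.sum_congr rfl fun j _ => Finset.sum_congr rfl fun l _ => ?_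
    rw [← hM j l, ← mul_assoc, mul_right_comm, ← integral_const_mul]
    refine integral_congr_ae (ae_of_all _ fun ω => ?_)
    simp only
    ring
  refine ⟨key t, Matrix.PosSemidef.of_dotProduct_mulVec_nonneg ?_ fun u => ?_⟩
  · ext j l
    simp only [Matrix.conjTranspose_apply, star_trivial, ← hM]
    simp_rw [mul_comm]
  · simp only [star_trivial]
    rw [← key u]
    exact integral_nonneg fun ω => sq_nonneg _

/-- The central limit theorem for centred random vectors. -/
theorem tendstoInDistribution_multivariateGaussian {Ω : Type*} [MeasurableSpace Ω]
    {μ : Measure Ω} [IsProbabilityMeasure μ] {X : ℕ → Ω → EuclideanSpace ℝ (Fin d)}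
    {M : Matrix (Fin d) (Fin d) ℝ} (hindep : iIndepFun X μ)
    (hident : ∀ k, IdentDistrib (X k) (X 0) μ μ)
    (hX : ∀ j, MemLp (fun ω => X 0 ω j) 2 μ) (hmean : ∀ j, ∫ ω, X 0 ω j ∂μ = 0)
    (hM : ∀ j l, ∫ ω, X 0 ω j * X 0 ω l ∂μ = M j l) :
    TendstoInDistribution (fun (n : ℕ) ω => (√(n : ℝ))⁻¹ • ∑ k ∈ Finset.range n, X k ω) atTop id
      (fun _ => μ) (multivariateGaussian 0 M) where
  forall_aemeasurable n :=
    (Finset.aemeasurable_fun_sum (Finset.range n) fun k _ =>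
      (hident k).aemeasurable_fst).fun_const_smul (√(n : ℝ))⁻¹
  aemeasurable_limit := aemeasurable_id
  tendsto := by
    have hMp := (posSemidef_of_second_moment hX hM 0).2
    refine ProbabilityMeasure.tendsto_iff_tendsto_charFun.2 fun t => ?_
    have hmX : ∀ n : ℕ, AEMeasurable (fun ω => (√(n : ℝ))⁻¹ • ∑ k ∈ Finset.range n, X k ω) μ :=
      fun n => (Finset.aemeasurable_fun_sum (Finset.range n) fun k _ =>
        (hident k).aemeasurable_fst).fun_const_smul (√(n : ℝ))⁻¹
    let f : EuclideanSpace ℝ (Fin d) → ℝ := fun z => inner ℝ z t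
    have hf : Measurable f := by fun_prop
    have hfe : ∀ z, f z = ∑ j, t j * z j := fun z => by
      simp [f, PiLp.inner_apply]
    have hmem : MemLp (fun ω => f (X 0 ω)) 2 μ := by
      simp_rw [hfe]
      exact memLp_finsetSum _ fun j _ => (hX j).const_mul _
    have h0 : ∫ ω, f (X 0 ω) ∂μ = 0 := by
      simp_rw [hfe]
      rw [integral_finsetSum _ fun j _ => ((hX j).const_mul _).integrable (by norm_num)]
      simp [integral_const_mul, hmean]
    have hvar : Var[fun ω => f (X 0 ω); μ] = t ⬝ᵥ M *ᵥ t := by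
      rw [variance_of_integral_eq_zero hmem.aestronglyMeasurable.aemeasurable h0]
      simp_rw [hfe]
      exact (posSemidef_of_second_moment hX hM _).1
    have hclt := tendstoInDistribution_inv_sqrt_mul_sum_sub (P := μ) (X := fun k ω => f (X k ω))
      (Y := id) (P' := gaussianReal 0 Var[fun ω => f (X 0 ω); μ].toNNReal) HasLaw.id hmem
      (hindep.comp (fun _ => f) fun _ => hf) (fun k => (hident k).comp hf)
    -- Cramér–Wold: the characteristic function of a vector at `t` is that of its projection `⟨·,
    -- t⟩` at `1`, so the scalar theorem suffices.
    have h1 := ProbabilityMeasure.tendsto_iff_tendsto_charFun.1 hclt.tendsto 1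
    simp only [ProbabilityMeasure.coe_mk, Measure.map_id] at h1 ⊢
    rw [charFun_multivariateGaussian hMp]
    have hlim : charFun (gaussianReal 0 Var[fun ω => f (X 0 ω); μ].toNNReal) 1
        = Complex.exp (inner ℝ t (0 : EuclideanSpace ℝ (Fin d)) * Complex.I
          - ((t : Fin d → ℝ) ⬝ᵥ M *ᵥ t : ℝ) / 2) := by
      rw [charFun_gaussianReal, hvar, Real.coe_toNNReal _ (by
        simpa using hMp.dotProduct_mulVec_nonneg (t : Fin d → ℝ))]
      simp
    rw [hlim] at h1
    refine h1.congr fun n => ?_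
    rw [charFun_apply, charFun_apply, integral_map, integral_map (hmX n)]
    · refine integral_congr_ae (ae_of_all _ fun ω => ?_)
      simp only [h0, mul_zero, sub_zero]
      congr 2
      simp [f, inner_smul_left, sum_inner]
    · fun_prop
    · exact (hf.comp_aemeasurable (hmX n)).congr (ae_of_all _ fun ω => by
        simp [f, inner_smul_left, sum_inner, h0])
    · fun_prop

end Collab

/-! ### Random linear systems: consistency and Slutsky's lemma -/

namespace Collab

variable {d : ℕ}

theorem tendsto_nsmul_inv {A : ℕ → Matrix (Fin d) (Fin d) ℝ} {H : Matrix (Fin d) (Fin d) ℝ}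
    (hA : Tendsto (fun n : ℕ => (n : ℝ)⁻¹ • A n) atTop (𝓝 H)) (hH : H.det ≠ 0) :
    (∀ᶠ n in atTop, IsUnit (A n).det) ∧
      Tendsto (fun n : ℕ => (n : ℝ) • (A n)⁻¹) atTop (𝓝 H⁻¹) := by
  have hdet : Tendsto (fun n : ℕ => ((n : ℝ)⁻¹ • A n).det) atTop (𝓝 H.det) :=
    ((continuous_id.matrix_det).tendsto H).comp hA
  have hunit : ∀ᶠ n in atTop, IsUnit (A n).det := by
    filter_upwards [hdet.eventually_ne hH] with n hn
    rw [Matrix.det_smul] at hn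
    exact (right_ne_zero_of_mul hn).isUnit
  refine ⟨hunit, ?_⟩
  -- Written as `det⁻¹ • adjugate`, inversion is continuous at `H` because `H.det ≠ 0`.
  have hinv : Tendsto (fun n : ℕ => ((n : ℝ)⁻¹ • A n)⁻¹) atTop (𝓝 H⁻¹) := by
    simp_rw [Matrix.inv_def, Ring.inverse_eq_inv']
    exact (hdet.inv₀ hH).smul (((continuous_id.matrix_adjugate).tendsto H).comp hA)
  refine hinv.congr' ?_
  filter_upwards [hunit, eventually_ne_atTop 0] with n hn hn0
  have hn0' : (n : ℝ) ≠ 0 := Nat.cast_ne_zero.2 hn0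
  refine Matrix.inv_eq_right_inv ?_
  rw [Matrix.smul_mul, Matrix.mul_smul, smul_smul, inv_mul_cancel₀ hn0', one_smul,
    Matrix.mul_nonsing_inv _ hn]

/-- The solution of the linear system with matrix `A` and right-hand side `A θ + u`
(zero if `A` is singular). -/
noncomputable def linearSolve (θ : EuclideanSpace ℝ (Fin d)) (A : Matrix (Fin d) (Fin d) ℝ)
    (u : EuclideanSpace ℝ (Fin d)) : EuclideanSpace ℝ (Fin d) :=
  WithLp.toLp 2 (A⁻¹ *ᵥ (A *ᵥ θ + u))

theorem linearSolve_sub {θ : EuclideanSpace ℝ (Fin d)} {A : Matrix (Fin d) (Fin d) ℝ}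
    (u : EuclideanSpace ℝ (Fin d)) (hA : IsUnit A.det) :
    linearSolve θ A u - θ = WithLp.toLp 2 (A⁻¹ *ᵥ u) := by
  ext j
  simp [linearSolve, Matrix.mulVec_add, Matrix.nonsing_inv_mul _ hA]

variable {Ω : Type*} [MeasurableSpace Ω] {μ : Measure Ω}

/-- The formula `det⁻¹ • adjugate` with `0⁻¹ = 0` also covers singular matrices and is measurable
everywhere, so invertibility plays no role. -/
theorem aemeasurable_matrix_inv {A : Ω → Matrix (Fin d) (Fin d) ℝ}
    (hA : ∀ j l, AEMeasurable (fun ω => A ω j l) μ) (j l : Fin d) :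
    AEMeasurable (fun ω => (A ω)⁻¹ j l) μ := by
  have hA' : AEMeasurable (fun ω (p : Fin d × Fin d) => A ω p.1 p.2) μ :=
    aemeasurable_pi_lambda _ fun p => hA p.1 p.2
  obtain ⟨F, hF, hFA⟩ : ∃ F : (Fin d × Fin d → ℝ) → Matrix (Fin d) (Fin d) ℝ, Continuous F ∧
      ∀ ω, F (fun p => A ω p.1 p.2) = A ω :=
    ⟨fun a => Matrix.of fun j l => a (j, l),
      continuous_matrix fun j l => continuous_apply (j, l), fun ω => rfl⟩
  have hf : Measurable fun a => (F a).det⁻¹ * (F a).adjugate j l :=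
    hF.matrix_det.measurable.inv.mul (hF.matrix_adjugate.matrix_elem j l).measurable
  refine (hf.comp_aemeasurable hA').congr (ae_of_all _ fun ω => ?_)
  simp only [Function.comp_apply, hFA, Matrix.inv_def, Ring.inverse_eq_inv', Matrix.smul_apply,
    smul_eq_mul]

theorem aemeasurable_toLp_mulVec {A : Ω → Matrix (Fin d) (Fin d) ℝ}
    {u : Ω → EuclideanSpace ℝ (Fin d)} (hA : ∀ j l, AEMeasurable (fun ω => A ω j l) μ)
    (hu : AEMeasurable u μ) :
    AEMeasurable (fun ω => (WithLp.toLp 2 (A ω *ᵥ u ω) : EuclideanSpace ℝ (Fin d))) μ := by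
  refine (WithLp.measurable_toLp 2 _).comp_aemeasurable (aemeasurable_pi_lambda _ fun j => ?_)
  simp only [Matrix.mulVec, dotProduct]
  refine Finset.aemeasurable_fun_sum _ fun l _ => (hA j l).mul ?_
  exact (by fun_prop : Measurable fun z : EuclideanSpace ℝ (Fin d) => z l).comp_aemeasurable hu

theorem aemeasurable_linearSolve {θ : EuclideanSpace ℝ (Fin d)}
    {A : Ω → Matrix (Fin d) (Fin d) ℝ}
    {u : Ω → EuclideanSpace ℝ (Fin d)} (hA : ∀ j l, AEMeasurable (fun ω => A ω j l) μ)
    (hu : AEMeasurable u μ) : AEMeasurable (fun ω => linearSolve θ (A ω) (u ω)) μ :=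
  aemeasurable_toLp_mulVec (u := fun ω => WithLp.toLp 2 (A ω *ᵥ θ) + u ω)
    (aemeasurable_matrix_inv hA) ((aemeasurable_toLp_mulVec hA aemeasurable_const).add hu)

variable {A : ℕ → Ω → Matrix (Fin d) (Fin d) ℝ} {u : ℕ → Ω → EuclideanSpace ℝ (Fin d)}
  {H M : Matrix (Fin d) (Fin d) ℝ} {θ : EuclideanSpace ℝ (Fin d)}

/-- Once `A n` is invertible, the error is `(n A⁻¹) (u / n)`, which tends to `H⁻¹ 0 = 0`. -/
theorem tendstoInMeasure_linearSolve [IsProbabilityMeasure μ]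
    (hAm : ∀ n j l, AEMeasurable (fun ω => A n ω j l) μ) (hum : ∀ n, AEMeasurable (u n) μ)
    (hA : ∀ᵐ ω ∂μ, Tendsto (fun n : ℕ => (n : ℝ)⁻¹ • A n ω) atTop (𝓝 H)) (hH : H.det ≠ 0)
    (hu : ∀ᵐ ω ∂μ, Tendsto (fun n : ℕ => (n : ℝ)⁻¹ • u n ω) atTop (𝓝 0)) :
    TendstoInMeasure μ (fun n ω => linearSolve θ (A n ω) (u n ω)) atTop fun _ => θ := by
  refine tendstoInMeasure_of_tendsto_ae
    (fun n => (aemeasurable_linearSolve (hAm n) (hum n)).aestronglyMeasurable) ?_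
  filter_upwards [hA, hu] with ω hAω huω
  obtain ⟨hunit, hinv⟩ := tendsto_nsmul_inv hAω hH
  have hcont : Continuous fun p : Matrix (Fin d) (Fin d) ℝ × EuclideanSpace ℝ (Fin d) =>
      (WithLp.toLp 2 (p.1 *ᵥ p.2) : EuclideanSpace ℝ (Fin d)) := by fun_prop
  have hlim := (hcont.tendsto (H⁻¹, 0)).comp (hinv.prodMk_nhds huω)
  have hlim' := hlim.const_add θ
  simp only [WithLp.ofLp_zero, Matrix.mulVec_zero, WithLp.toLp_zero, add_zero] at hlim'
  refine hlim'.congr' ?_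
  filter_upwards [hunit, eventually_ne_atTop 0] with n hn hn0
  have hn0' : (n : ℝ) ≠ 0 := Nat.cast_ne_zero.2 hn0
  rw [sub_eq_iff_eq_add'.1 (linearSolve_sub (u n ω) hn)]
  simp [Matrix.smul_mulVec, Matrix.mulVec_smul, smul_smul, hn0']

/-- Only the law of the limit matters; this replaces the limit `H⁻¹ Z` produced by Slutsky's lemma
by the identity under the law of `H⁻¹ Z`. -/
theorem tendstoInDistribution_limit_congr {E Ω' Ω'' : Type*} [TopologicalSpace E]
    [MeasurableSpace E] [OpensMeasurableSpace E] [MeasurableSpace Ω'] [MeasurableSpace Ω'']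
    [IsProbabilityMeasure μ] {μ' : Measure Ω'} {μ'' : Measure Ω''} [IsProbabilityMeasure μ']
    [IsProbabilityMeasure μ''] {X : ℕ → Ω → E} {Z : Ω' → E} {Z' : Ω'' → E}
    (h : TendstoInDistribution X atTop Z (fun _ => μ) μ') (hZ' : AEMeasurable Z' μ'')
    (hZ : μ'.map Z = μ''.map Z') : TendstoInDistribution X atTop Z' (fun _ => μ) μ'' where
  forall_aemeasurable := h.forall_aemeasurable
  aemeasurable_limit := hZ'
  tendsto := by
    have hlim := h.tendsto
    have heq : (⟨μ'.map Z, Measure.isProbabilityMeasure_map h.aemeasurable_limit⟩ :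
        ProbabilityMeasure E) = ⟨μ''.map Z', Measure.isProbabilityMeasure_map hZ'⟩ :=
      Subtype.ext hZ
    rwa [heq] at hlim

/-- Characteristic functions agree because `⟨B z, t⟩ = ⟨z, Bᵀ t⟩`. -/
theorem multivariateGaussian_map_mulVec (hM : M.PosSemidef) (B : Matrix (Fin d) (Fin d) ℝ) :
    (multivariateGaussian 0 M).map
        (fun z : EuclideanSpace ℝ (Fin d) => (WithLp.toLp 2 (B *ᵥ z) : EuclideanSpace ℝ (Fin d)))
      = multivariateGaussian 0 (B * M * Bᵀ) := by
  have hBM : (B * M * Bᵀ).PosSemidef := by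
    simpa using hM.mul_mul_conjTranspose_same B
  have hm : Measurable fun z : EuclideanSpace ℝ (Fin d) =>
      (WithLp.toLp 2 (B *ᵥ z) : EuclideanSpace ℝ (Fin d)) :=
    Continuous.measurable (by fun_prop)
  have : IsProbabilityMeasure ((multivariateGaussian 0 M).map
      (fun z : EuclideanSpace ℝ (Fin d) => (WithLp.toLp 2 (B *ᵥ z) : EuclideanSpace ℝ (Fin d)))) :=
    Measure.isProbabilityMeasure_map hm.aemeasurable
  refine Measure.ext_of_charFun (funext fun t => ?_)
  have hadj : ∀ z : EuclideanSpace ℝ (Fin d),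
      inner ℝ (WithLp.toLp 2 (B *ᵥ z) : EuclideanSpace ℝ (Fin d)) t
        = inner ℝ z (WithLp.toLp 2 (Bᵀ *ᵥ t) : EuclideanSpace ℝ (Fin d)) := fun z => by
    simp only [EuclideanSpace.inner_eq_star_dotProduct, star_trivial]
    rw [Matrix.dotProduct_mulVec, Matrix.mulVec_transpose]
  rw [charFun_apply, integral_map hm.aemeasurable (by fun_prop)]
  simp_rw [hadj]
  rw [← charFun_apply, charFun_multivariateGaussian hM, charFun_multivariateGaussian hBM]
  simp only [inner_zero_right, ← Matrix.mulVec_mulVec]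
  rw [Matrix.dotProduct_mulVec t B, ← Matrix.mulVec_transpose]

/-- Slutsky: where `A n` is invertible, the scaled error is `(n A⁻¹) (u / √n)`, with the first
factor converging to the constant `H⁻¹` and the second to a Gaussian vector. -/
theorem tendstoInDistribution_linearSolve [IsProbabilityMeasure μ]
    (hAm : ∀ n j l, AEMeasurable (fun ω => A n ω j l) μ) (hum : ∀ n, AEMeasurable (u n) μ)
    (hA : ∀ᵐ ω ∂μ, Tendsto (fun n : ℕ => (n : ℝ)⁻¹ • A n ω) atTop (𝓝 H)) (hH : H.det ≠ 0)
    (hM : M.PosSemidef)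
    (hu : TendstoInDistribution (fun (n : ℕ) ω => (√(n : ℝ))⁻¹ • u n ω) atTop id
      (fun _ => μ) (multivariateGaussian 0 M)) :
    TendstoInDistribution (fun (n : ℕ) ω => √(n : ℝ) • (linearSolve θ (A n ω) (u n ω) - θ))
      atTop id (fun _ => μ) (multivariateGaussian 0 (H⁻¹ * M * (H⁻¹)ᵀ)) := by
  -- Typed as a function, so that convergence in measure refers to the sup metric of the function
  -- space.
  let B : ℕ → Ω → Fin d → Fin d → ℝ := fun n ω => (n : ℝ) • (A n ω)⁻¹
  have hBm : ∀ n, AEMeasurable (B n) μ := fun n =>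
    aemeasurable_pi_lambda _ fun j => aemeasurable_pi_lambda _ fun l =>
      (aemeasurable_matrix_inv (hAm n) j l).const_mul (n : ℝ)
  have hB : TendstoInMeasure μ B atTop fun _ => (H⁻¹ : Matrix (Fin d) (Fin d) ℝ) := by
    refine tendstoInMeasure_of_tendsto_ae (fun n => (hBm n).aestronglyMeasurable) ?_
    filter_upwards [hA] with ω hω
    exact (tendsto_nsmul_inv hω hH).2
  let g : EuclideanSpace ℝ (Fin d) × (Fin d → Fin d → ℝ) → EuclideanSpace ℝ (Fin d) :=
    fun p => WithLp.toLp 2 ((Matrix.of p.2) *ᵥ p.1)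
  have hg : Continuous g := by
    refine (PiLp.continuous_toLp 2 _).comp (continuous_pi fun j => ?_)
    simp only [Matrix.mulVec, dotProduct, Matrix.of_apply]
    fun_prop
  have hmain := hu.continuous_comp_prodMk_of_tendstoInMeasure_const hg hB hBm
  refine tendstoInDistribution_limit_congr
    (tendstoInDistribution_of_tendstoInMeasure_sub _ _ hmain ?_ fun n => ?_) aemeasurable_id ?_
  -- Almost surely the scaled error equals `(n A⁻¹) (u / √n)` exactly for all large `n`; singular `A
  -- n` occur only finitely often.
  · refine tendstoInMeasure_of_tendsto_ae (fun n => ?_) ?_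
    · exact (((aemeasurable_linearSolve (hAm n) (hum n)).sub_const θ).const_smul
        (√(n : ℝ))).aestronglyMeasurable.sub
        (hmain.forall_aemeasurable n).aestronglyMeasurable
    · filter_upwards [hA] with ω hω
      refine tendsto_const_nhds.congr' ?_
      filter_upwards [(tendsto_nsmul_inv hω hH).1, eventually_ne_atTop 0] with n hn hn0
      have hn0' : √(n : ℝ) ≠ 0 := Real.sqrt_ne_zero'.2 (Nat.cast_pos.2 (Nat.pos_of_ne_zero hn0))
      have hs : (n : ℝ) = √(n : ℝ) * √(n : ℝ) := (Real.mul_self_sqrt (Nat.cast_nonneg n)).symm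
      have hcoe : Matrix.of (B n ω) = (n : ℝ) • (A n ω)⁻¹ := rfl
      simp only [Pi.sub_apply, Pi.zero_apply, g, hcoe, linearSolve_sub (u n ω) hn]
      rw [WithLp.ofLp_smul, Matrix.mulVec_smul, Matrix.smul_mulVec, smul_smul, ← WithLp.toLp_smul]
      have : (√(n : ℝ))⁻¹ * (n : ℝ) = √(n : ℝ) := by
        nth_rw 2 [hs]
        rw [inv_mul_cancel_left₀ hn0']
      rw [this, sub_self]
  · exact ((aemeasurable_linearSolve (hAm n) (hum n)).sub_const θ).const_smul (√(n : ℝ))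
  · rw [Measure.map_id, ← multivariateGaussian_map_mulVec hM]
    rfl

end Collab

/-! ### Linear algebra of imputation -/

namespace Collab

section Agent

variable {d p q : ℕ} (π : Fin p ⊕ Fin q ≃ Fin d) {S : Matrix (Fin d) (Fin d) ℝ}
  (θ : EuclideanSpace ℝ (Fin d))

theorem viewPlus_mulVec (v : Fin d → ℝ) (a : Fin p) :
    (viewPlus π *ᵥ v) a = v (π (Sum.inl a)) := by
  simp [viewPlus, Matrix.mulVec, dotProduct, Matrix.one_apply]

theorem transpose_view_mul_view :
    (viewPlus π)ᵀ * viewPlus π + (viewMinus π)ᵀ * viewMinus π = 1 := by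
  ext j l
  have h := (π.sum_comp fun k => (1 : Matrix (Fin d) (Fin d) ℝ) k j * (1 : Matrix _ _ ℝ) k l)
  rw [Fintype.sum_sum_type] at h
  simp only [Matrix.add_apply, Matrix.mul_apply, Matrix.transpose_apply, viewPlus, viewMinus,
    Matrix.submatrix_apply]
  refine Eq.trans h ?_
  simp [Matrix.one_apply, eq_comm]

theorem blockPlus_posDef (hS : S.PosDef) : (blockPlus π S).PosDef := by
  have h := hS.submatrix (e := fun a => π (Sum.inl a))
    (π.injective.comp Sum.inl_injective)
  convert h using 1
  ext a b
  simp [blockPlus, viewPlus, Matrix.mul_apply, Matrix.one_apply]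

theorem isUnit_det_blockPlus (hS : S.PosDef) : IsUnit (blockPlus π S).det :=
  (blockPlus_posDef π hS).det_pos.ne'.isUnit

theorem transpose_eq_of_posDef {ι : Type*} {A : Matrix ι ι ℝ} (hA : A.PosDef) : Aᵀ = A := by
  simpa using hA.isHermitian.eq

theorem imputeMat_eq :
    imputeMat π S = viewPlus π + (blockPlus π S)⁻¹ * blockPlusMinus π S * viewMinus π := by
  rw [imputeMat, Matrix.fromCols_mul_fromRows, Matrix.one_mul]

/-- Multiplying by `Σ₊` clears the inverse and leaves `Π₊ Σ Πᵀ Π`, and the permutation matrix is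
orthogonal. -/
theorem blockPlus_mul_imputeMat (hS : S.PosDef) :
    blockPlus π S * imputeMat π S = viewPlus π * S := by
  rw [imputeMat_eq, Matrix.mul_add, Matrix.mul_assoc (blockPlus π S)⁻¹,
    Matrix.mul_nonsing_inv_cancel_left _ _ (isUnit_det_blockPlus π hS), blockPlus, blockPlusMinus]
  simp only [Matrix.mul_assoc]
  rw [← Matrix.mul_add, ← Matrix.mul_add, transpose_view_mul_view, Matrix.mul_one]

/-- The vector `g` with `⟨θ₋, z⟩ = ⟨g, x⟩`, where `z` is the residual of `x`. -/
noncomputable def residualDir (S : Matrix (Fin d) (Fin d) ℝ) : Fin d → ℝ :=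
  (viewMinus π - blockMinusPlus π S * (blockPlus π S)⁻¹ * viewPlus π)ᵀ *ᵥ (viewMinus π *ᵥ θ)

theorem dotProduct_residual (x : EuclideanSpace ℝ (Fin d)) :
    (viewMinus π *ᵥ θ) ⬝ᵥ residual π S x = residualDir π θ S ⬝ᵥ x := by
  rw [residual, residualDir, Matrix.mulVec_mulVec, ← Matrix.sub_mulVec, Matrix.dotProduct_mulVec,
    Matrix.mulVec_transpose]

theorem transpose_blockMinusPlus_mul_inv (hS : S.PosDef) :
    (blockMinusPlus π S * (blockPlus π S)⁻¹)ᵀ = (blockPlus π S)⁻¹ * blockPlusMinus π S := by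
  rw [Matrix.transpose_mul, Matrix.transpose_nonsing_inv,
    transpose_eq_of_posDef (blockPlus_posDef π hS)]
  congr 1
  simp [blockMinusPlus, blockPlusMinus, transpose_eq_of_posDef hS, Matrix.mul_assoc]

/-- The two terms `Π₊ᵀ Σ₊⁻¹ Σ± Π₋` cancel. This splits a label into its imputed prediction and the
residual. -/
theorem transpose_mulVec_imputeMat_add_residualDir (hS : S.PosDef) :
    (viewPlus π)ᵀ *ᵥ (imputeMat π S *ᵥ θ) + residualDir π θ S = θ := by
  have h : (viewPlus π)ᵀ * imputeMat π S +
      (viewMinus π - blockMinusPlus π S * (blockPlus π S)⁻¹ * viewPlus π)ᵀ * viewMinus π = 1 := by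
    rw [Matrix.transpose_sub, Matrix.transpose_mul, transpose_blockMinusPlus_mul_inv π hS,
      imputeMat_eq, ← transpose_view_mul_view π]
    simp only [Matrix.mul_add, Matrix.sub_mul, Matrix.mul_assoc]
    abel
  rw [residualDir, Matrix.mulVec_mulVec, Matrix.mulVec_mulVec, ← Matrix.add_mulVec, h,
    Matrix.one_mulVec]

/-- These are the normal equations of the best linear prediction: the left side is the covariance of
`x₊` with `⟨θ₋, z⟩`. -/
theorem viewPlus_mul_residualDir (hS : S.PosDef) :
    viewPlus π *ᵥ (S *ᵥ residualDir π θ S) = 0 := by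
  have h : viewPlus π * S *
      (viewMinus π - blockMinusPlus π S * (blockPlus π S)⁻¹ * viewPlus π)ᵀ = 0 := by
    rw [Matrix.transpose_sub, Matrix.transpose_mul, transpose_blockMinusPlus_mul_inv π hS,
      Matrix.mul_sub, ← Matrix.mul_assoc (viewPlus π * S)]
    change blockPlusMinus π S - blockPlus π S * _ = 0
    rw [Matrix.mul_nonsing_inv_cancel_left _ _ (isUnit_det_blockPlus π hS), sub_self]
  rw [residualDir, Matrix.mulVec_mulVec, Matrix.mulVec_mulVec, h, Matrix.zero_mulVec]

/-- Expanding one copy of `g`, the component through `Π₊` vanishes by the normal equations; the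
component through `Π₋` yields the Schur complement. -/
theorem residualDir_quadForm (hS : S.PosDef) :
    residualDir π θ S ⬝ᵥ S *ᵥ residualDir π θ S
      = quadForm (schurMinus π S) (viewMinus π *ᵥ θ) := by
  have h : viewMinus π * S *
      (viewMinus π - blockMinusPlus π S * (blockPlus π S)⁻¹ * viewPlus π)ᵀ = schurMinus π S := by
    rw [Matrix.transpose_sub, Matrix.transpose_mul, transpose_blockMinusPlus_mul_inv π hS,
      Matrix.mul_sub, schurMinus, ← Matrix.mul_assoc (viewMinus π * S)]
    simp only [blockMinus, blockMinusPlus, Matrix.mul_assoc]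
  have h0 := viewPlus_mul_residualDir π θ hS
  nth_rw 1 [residualDir]
  rw [Matrix.mulVec_transpose, ← Matrix.dotProduct_mulVec, Matrix.sub_mulVec,
    ← Matrix.mulVec_mulVec _ _ (viewPlus π), h0, Matrix.mulVec_zero, sub_zero, residualDir,
    Matrix.mulVec_mulVec, Matrix.mulVec_mulVec, h, quadForm]

end Agent

section Agents

variable {m d : ℕ} {r : Fin m → ℕ} (π : ∀ i, Fin (r i) ⊕ Fin (d - r i) ≃ Fin d)
  {S : Matrix (Fin d) (Fin d) ℝ}

/-- If every `Tᵢ v` vanishes, then so does every `Σᵢ₊ Tᵢ v = Πᵢ₊ Σ v`. Coverage of all features then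
forces `Σ v = 0`, hence `v = 0`. -/
theorem sum_smul_posDef (hcover : ∀ j : Fin d, ∃ (i : Fin m) (a : Fin (r i)), π i (Sum.inl a) = j)
    (hS : S.PosDef) {α : Fin m → ℝ} (hα : ∀ i, 0 < α i) :
    (∑ i, α i • ((imputeMat (π i) S)ᵀ * blockPlus (π i) S * imputeMat (π i) S)).PosDef := by
  have hK : ∀ i, ((imputeMat (π i) S)ᵀ * blockPlus (π i) S * imputeMat (π i) S).PosSemidef :=
    fun i => by
      simpa using (blockPlus_posDef (π i) hS).posSemidef.conjTranspose_mul_mul_same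
        (imputeMat (π i) S)
  have hsum : (∑ i, α i • ((imputeMat (π i) S)ᵀ * blockPlus (π i) S *
      imputeMat (π i) S)).PosSemidef :=
    Matrix.posSemidef_sum _ fun i _ => (hK i).smul (hα i).le
  refine Matrix.PosDef.of_dotProduct_mulVec_pos hsum.isHermitian fun v hv => ?_
  rw [Matrix.sum_mulVec, dotProduct_sum]
  simp only [star_trivial, Matrix.smul_mulVec, dotProduct_smul, smul_eq_mul]
  have hterm : ∀ i, 0 ≤ α i * v ⬝ᵥ ((imputeMat (π i) S)ᵀ * blockPlus (π i) S *
      imputeMat (π i) S) *ᵥ v := fun i =>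
    mul_nonneg (hα i).le (by simpa using (hK i).dotProduct_mulVec_nonneg v)
  have hSv : S *ᵥ v ≠ 0 := fun h => by
    have := hS.dotProduct_mulVec_pos hv
    simp [h] at this
  obtain ⟨j, hj⟩ := Function.ne_iff.1 hSv
  obtain ⟨i, a, hia⟩ := hcover j
  refine Finset.sum_pos' (fun i _ => hterm i) ⟨i, Finset.mem_univ _, mul_pos (hα i) ?_⟩
  have hT : imputeMat (π i) S *ᵥ v ≠ 0 := fun h => by
    have h1 : (blockPlus (π i) S * imputeMat (π i) S) *ᵥ v = 0 := by
      rw [← Matrix.mulVec_mulVec, h, Matrix.mulVec_zero]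
    rw [blockPlus_mul_imputeMat _ hS, ← Matrix.mulVec_mulVec] at h1
    have h2 := congrFun h1 a
    rw [viewPlus_mulVec, hia] at h2
    exact hj h2
  have := (blockPlus_posDef (π i) hS).dotProduct_mulVec_pos hT
  rw [← Matrix.mulVec_mulVec, ← Matrix.mulVec_mulVec, Matrix.dotProduct_mulVec,
    Matrix.vecMul_transpose]
  simpa using this

end Agents

/-! ### Optimal weights for sandwich covariances -/

section GaussMarkov

variable {ι κ : Type*} [Fintype ι] [Fintype κ] [DecidableEq κ]

/-- Among the sandwich covariances `(∑ αᵢ Kᵢ)⁻¹ (∑ αᵢ² qᵢ Kᵢ) (∑ αᵢ Kᵢ)⁻¹` the weights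
`αᵢ = 1 / qᵢ` give the smallest one. -/
theorem sandwich_sub_posSemidef {K : ι → Matrix κ κ ℝ} {w c : ι → ℝ}
    (hK : ∀ i, (K i).PosSemidef) (hc : ∀ i, 0 < c i)
    (hH : (∑ i, w i • K i).PosDef) (hN : (∑ i, (c i)⁻¹ • K i).PosDef) :
    ((∑ i, w i • K i)⁻¹ * (∑ i, w i ^ 2 • c i • K i) * (∑ i, w i • K i)⁻¹
      - (∑ i, (c i)⁻¹ • K i)⁻¹).PosSemidef := by
  set H := ∑ i, w i • K i with hHdef
  set N := ∑ i, (c i)⁻¹ • K i with hNdef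
  have hHu : IsUnit H.det := hH.det_pos.ne'.isUnit
  have hNu : IsUnit N.det := hN.det_pos.ne'.isUnit
  have hHt : H⁻¹ᵀ = H⁻¹ := by rw [Matrix.transpose_nonsing_inv, transpose_eq_of_posDef hH]
  have hNt : N⁻¹ᵀ = N⁻¹ := by rw [Matrix.transpose_nonsing_inv, transpose_eq_of_posDef hN]
  -- Completing the square: with `Dᵢ = wᵢ H⁻¹ - cᵢ⁻¹ N⁻¹`, the difference is `∑ cᵢ Dᵢᵀ Kᵢ Dᵢ`. Each
  -- cross term sums to `-N⁻¹`, since `∑ wᵢ Kᵢ = H`, and the last square sums to `N⁻¹`.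
  have hterm : ∀ i, (c i • ((w i • H⁻¹ - (c i)⁻¹ • N⁻¹)ᵀ * K i *
      (w i • H⁻¹ - (c i)⁻¹ • N⁻¹))).PosSemidef := fun i => by
    simpa using ((hK i).conjTranspose_mul_mul_same
      (w i • H⁻¹ - (c i)⁻¹ • N⁻¹)).smul (hc i).le
  convert Matrix.posSemidef_sum Finset.univ fun i _ => hterm i using 1
  have hexp : ∀ i, c i • ((w i • H⁻¹ - (c i)⁻¹ • N⁻¹)ᵀ * K i * (w i • H⁻¹ - (c i)⁻¹ • N⁻¹))
      = H⁻¹ * (w i ^ 2 • c i • K i) * H⁻¹ - H⁻¹ * (w i • K i) * N⁻¹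
        - N⁻¹ * (w i • K i) * H⁻¹ + N⁻¹ * ((c i)⁻¹ • K i) * N⁻¹ := fun i => by
    have hci := (hc i).ne'
    rw [Matrix.transpose_sub, Matrix.transpose_smul, Matrix.transpose_smul, hHt, hNt]
    simp only [Matrix.sub_mul, Matrix.mul_sub, Matrix.smul_mul, Matrix.mul_smul, smul_sub,
      smul_smul]
    have e1 : c i * (w i * w i) = w i ^ 2 * c i := by ring
    have e2 : c i * ((c i)⁻¹ * w i) = w i := by field_simp
    have e3 : c i * (w i * (c i)⁻¹) = w i := by field_simp
    have e4 : c i * ((c i)⁻¹ * (c i)⁻¹) = (c i)⁻¹ := by field_simp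
    simp only [e1, e2, e3, e4]
    abel
  simp_rw [hexp]
  rw [Finset.sum_add_distrib, Finset.sum_sub_distrib, Finset.sum_sub_distrib]
  simp only [← Finset.sum_mul, ← Finset.mul_sum]
  rw [← hHdef, ← hNdef, Matrix.nonsing_inv_mul _ hHu, Matrix.nonsing_inv_mul _ hNu,
    Matrix.mul_assoc N⁻¹ H, Matrix.mul_nonsing_inv _ hHu, Matrix.one_mul, Matrix.mul_one]
  abel

end GaussMarkov

end Collab

/-! ### Moments of features, noise and agent scores -/

theorem ProbabilityTheory.HasLaw.memLp_comp {Ω E : Type*} [MeasurableSpace Ω] [MeasurableSpace E]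
    {P : Measure Ω} {ν : Measure E} {X : Ω → E} (hX : HasLaw X ν P) {f : E → ℝ} {s : ENNReal}
    (hf : MemLp f s ν) : MemLp (fun ω => f (X ω)) s P :=
  MemLp.comp_of_map (hX.map_eq.symm ▸ hf) hX.aemeasurable

/-- A product of independent square-integrable variables is square-integrable. -/
theorem ProbabilityTheory.IndepFun.memLp_two_mul {Ω : Type*} [MeasurableSpace Ω] {P : Measure Ω}
    {X Y : Ω → ℝ} (hXY : IndepFun X Y P) (hX : MemLp X 2 P) (hY : MemLp Y 2 P) :
    MemLp (fun ω => X ω * Y ω) 2 P := by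
  refine (memLp_two_iff_integrable_sq (hX.1.mul hY.1)).2 ?_
  have h := (hXY.comp (φ := fun a => a ^ 2) (ψ := fun a => a ^ 2)
    (by fun_prop) (by fun_prop)).integrable_mul hX.integrable_sq hY.integrable_sq
  refine h.congr (ae_of_all _ fun ω => ?_)
  simp [mul_pow]

/-- The noise variables have mean zero and second moment `σ²`. -/
theorem ProbabilityTheory.HasLaw.moments_gaussianReal {Ω : Type*} [MeasurableSpace Ω]
    {P : Measure Ω} {e : Ω → ℝ} {σ : ℝ} (he : HasLaw e (gaussianReal 0 (σ ^ 2).toNNReal) P) :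
    MemLp e 2 P ∧ ∫ ω, e ω ∂P = 0 ∧ ∫ ω, e ω ^ 2 ∂P = σ ^ 2 := by
  have h0 : ∫ ω, e ω ∂P = 0 := by
    rw [he.integral_eq, integral_id_gaussianReal]
  refine ⟨he.memLp_comp (f := id) (memLp_id_gaussianReal 2), h0, ?_⟩
  rw [← variance_of_integral_eq_zero he.aemeasurable h0, he.variance_eq,
    variance_id_gaussianReal, Real.coe_toNNReal _ (sq_nonneg σ)]

namespace Collab

section Features

variable {d : ℕ} {P : Measure (EuclideanSpace ℝ (Fin d))} {S : Matrix (Fin d) (Fin d) ℝ}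

theorem memLp_dotProduct (hP : MemLp id 2 P) (v : Fin d → ℝ) :
    MemLp (fun x : EuclideanSpace ℝ (Fin d) => v ⬝ᵥ x) 2 P :=
  memLp_finsetSum _ fun j _ => (hP.eval_piLp j).const_mul _

variable [IsProbabilityMeasure P]

theorem integral_dotProduct (hP : MemLp id 2 P) (hmean : ∫ x, x ∂P = 0) (v : Fin d → ℝ) :
    ∫ x : EuclideanSpace ℝ (Fin d), v ⬝ᵥ x ∂P = 0 := by
  have hint : ∀ j, Integrable (fun x : EuclideanSpace ℝ (Fin d) => x j) P := fun j =>
    (hP.eval_piLp j).integrable (by norm_num)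
  have h0 : ∀ j, ∫ x : EuclideanSpace ℝ (Fin d), x j ∂P = 0 := fun j => by
    rw [← eval_integral_piLp hint, hmean, PiLp.zero_apply]
  simp only [dotProduct]
  rw [integral_finsetSum _ fun j _ => (hint j).const_mul _]
  simp [integral_const_mul, h0]

theorem integral_dotProduct_mul_dotProduct (hP : MemLp id 2 P) (hmean : ∫ x, x ∂P = 0)
    (hcov : ∀ j k : Fin d, cov[fun x => x j, fun x => x k; P] = S j k) (v w : Fin d → ℝ) :
    ∫ x : EuclideanSpace ℝ (Fin d), (v ⬝ᵥ x) * (w ⬝ᵥ x) ∂P = v ⬝ᵥ S *ᵥ w := by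
  have hmem : ∀ j, MemLp (fun x : EuclideanSpace ℝ (Fin d) => x j) 2 P := fun j => hP.eval_piLp j
  have h0 : ∀ j, ∫ x : EuclideanSpace ℝ (Fin d), x j ∂P = 0 := fun j => by
    simpa using integral_dotProduct hP hmean (Pi.single j 1)
  have hjk : ∀ j k, ∫ x : EuclideanSpace ℝ (Fin d), x j * x k ∂P = S j k := fun j k => by
    have h := covariance_eq_sub (hmem j) (hmem k)
    rw [hcov, h0, zero_mul, sub_zero] at h
    exact h.symm
  simp_rw [dotProduct, Matrix.mulVec, dotProduct, Finset.sum_mul_sum, Finset.mul_sum]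
  have hint : ∀ j k, Integrable (fun x : EuclideanSpace ℝ (Fin d) => v j * x j * (w k * x k)) P :=
    fun j k => ((hmem j).const_mul _).integrable_mul ((hmem k).const_mul _)
  rw [integral_finsetSum _ fun j _ => integrable_finsetSum _ fun k _ => hint j k]
  refine Finset.sum_congr rfl fun j _ => ?_
  rw [integral_finsetSum _ fun k _ => hint j k]
  refine Finset.sum_congr rfl fun k _ => ?_
  simp_rw [mul_mul_mul_comm (v j)]
  rw [integral_const_mul, hjk]
  ring

end Features

section Agent

variable {d p q : ℕ} (π : Fin p ⊕ Fin q ≃ Fin d) {S : Matrix (Fin d) (Fin d) ℝ}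
  (θ : EuclideanSpace ℝ (Fin d)) {P : Measure (EuclideanSpace ℝ (Fin d))}

theorem viewPlus_mulVec_eq_dotProduct (x : Fin d → ℝ) (a : Fin p) :
    (viewPlus π *ᵥ x) a = viewPlus π a ⬝ᵥ x := rfl

theorem viewPlus_dotProduct_mulVec (a b : Fin p) :
    viewPlus π a ⬝ᵥ S *ᵥ viewPlus π b = blockPlus π S a b := by
  simp [blockPlus, Matrix.mul_apply, dotProduct, Matrix.mulVec, Finset.mul_sum, Finset.sum_mul,
    mul_assoc]
  rw [Finset.sum_comm]

/-- The noise of the imputed regression, `⟨θ₋, z⟩ + e`, times the observed features. -/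
noncomputable def agentScore (S : Matrix (Fin d) (Fin d) ℝ)
    (w : EuclideanSpace ℝ (Fin d) × ℝ) : Fin p → ℝ :=
  (residualDir π θ S ⬝ᵥ w.1 + w.2) • (viewPlus π *ᵥ w.1)

theorem agentScore_apply (w : EuclideanSpace ℝ (Fin d) × ℝ) (a : Fin p) :
    agentScore π θ S w a = (viewPlus π a ⬝ᵥ w.1) * (residualDir π θ S ⬝ᵥ w.1)
      + (viewPlus π a ⬝ᵥ w.1) * w.2 := by
  rw [agentScore, Pi.smul_apply, smul_eq_mul, viewPlus_mulVec_eq_dotProduct]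
  ring

/-- A single observed coordinate is dominated by `‖x₊‖`. -/
theorem HasScoreCov.memLp (h : HasScoreCov π S θ P) (a : Fin p) :
    MemLp (fun x : EuclideanSpace ℝ (Fin d) =>
      (viewPlus π a ⬝ᵥ x) * (residualDir π θ S ⬝ᵥ x)) 2 P := by
  have hm : Measurable fun x : EuclideanSpace ℝ (Fin d) =>
      (viewPlus π a ⬝ᵥ x) * (residualDir π θ S ⬝ᵥ x) := by
    simp only [dotProduct]
    fun_prop
  refine (memLp_two_iff_integrable_sq hm.aestronglyMeasurable).2 ?_
  refine Integrable.mono h (hm.pow_const 2).aestronglyMeasurable (ae_of_all _ fun x => ?_)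
  have hnn : 0 ≤ (viewPlus π *ᵥ x) ⬝ᵥ (viewPlus π *ᵥ x) :=
    Finset.sum_nonneg fun i _ => mul_self_nonneg _
  rw [dotProduct_residual, Real.norm_of_nonneg (sq_nonneg _),
    Real.norm_of_nonneg (mul_nonneg hnn (sq_nonneg _)), mul_pow]
  refine mul_le_mul_of_nonneg_right ?_ (sq_nonneg _)
  rw [sq, ← viewPlus_mulVec_eq_dotProduct]
  exact Finset.single_le_sum (f := fun a => (viewPlus π *ᵥ x) a * (viewPlus π *ᵥ x) a)
    (fun i _ => mul_self_nonneg _) (Finset.mem_univ a)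

variable {Ω : Type*} [MeasurableSpace Ω] {μ : Measure Ω} {σ : ℝ}
  {X : Ω → EuclideanSpace ℝ (Fin d)} {e : Ω → ℝ}

theorem measurable_dotProduct {d : ℕ} (v : Fin d → ℝ) :
    Measurable fun x : EuclideanSpace ℝ (Fin d) => v ⬝ᵥ x := by
  simp only [dotProduct]
  fun_prop

theorem memLp_observed_mul_noise (hP : MemLp id 2 P) (hX : HasLaw X P μ)
    (he : HasLaw e (gaussianReal 0 (σ ^ 2).toNNReal) μ) (hXe : IndepFun X e μ) (a : Fin p) :
    MemLp (fun ω => (viewPlus π a ⬝ᵥ X ω) * e ω) 2 μ :=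
  (hXe.comp (measurable_dotProduct (viewPlus π a)) measurable_id).memLp_two_mul
    (hX.memLp_comp (memLp_dotProduct hP _)) he.moments_gaussianReal.1

/-- The residual part is centred by the normal equations, the noise part by independence. Second
moments of the features suffice, which is why consistency needs no condition on `Q`. -/
theorem integral_agentScore [IsProbabilityMeasure P] [IsProbabilityMeasure μ] (hS : S.PosDef) (hP : MemLp id 2 P)
    (hmean : ∫ x, x ∂P = 0)
    (hcov : ∀ j k : Fin d, cov[fun x => x j, fun x => x k; P] = S j k)
    (hX : HasLaw X P μ) (he : HasLaw e (gaussianReal 0 (σ ^ 2).toNNReal) μ)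
    (hXe : IndepFun X e μ) (a : Fin p) :
    Integrable (fun ω => agentScore π θ S (X ω, e ω) a) μ ∧
      ∫ ω, agentScore π θ S (X ω, e ω) a ∂μ = 0 := by
  have hv : ∀ v : Fin d → ℝ, MemLp (fun ω => v ⬝ᵥ X ω) 2 μ := fun v =>
    hX.memLp_comp (memLp_dotProduct hP v)
  have h1 : Integrable (fun ω => (viewPlus π a ⬝ᵥ X ω) * (residualDir π θ S ⬝ᵥ X ω)) μ :=
    (hv _).integrable_mul (hv _)
  have h2 : Integrable (fun ω => (viewPlus π a ⬝ᵥ X ω) * e ω) μ :=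
    (memLp_observed_mul_noise π hP hX he hXe a).integrable (by norm_num)
  simp_rw [agentScore_apply]
  refine ⟨h1.add h2, ?_⟩
  rw [integral_add h1 h2]
  have e1 : ∫ ω, (viewPlus π a ⬝ᵥ X ω) * (residualDir π θ S ⬝ᵥ X ω) ∂μ = 0 := by
    have h := hX.integral_comp (f := fun x : EuclideanSpace ℝ (Fin d) =>
      (viewPlus π a ⬝ᵥ x) * (residualDir π θ S ⬝ᵥ x))
      ((measurable_dotProduct _).mul (measurable_dotProduct _)).aestronglyMeasurable
    refine h.trans ?_
    rw [integral_dotProduct_mul_dotProduct hP hmean hcov]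
    exact congrFun (viewPlus_mul_residualDir π θ hS) a
  have e2 : ∫ ω, (viewPlus π a ⬝ᵥ X ω) * e ω ∂μ = 0 := by
    have h := (hXe.comp (measurable_dotProduct (viewPlus π a))
      measurable_id).integral_fun_mul_eq_mul_integral (hv _).1 he.aemeasurable.aestronglyMeasurable
    refine h.trans ?_
    simp only [Function.comp_def, id, he.moments_gaussianReal.2.1, mul_zero]
  rw [e1, e2, add_zero]

/-- Residual times residual gives the expectation in `scoreCov`, noise times noise gives `σ² Σ₊`,
and the mixed terms vanish because the noise is centred and independent of the features. -/
theorem second_moment_agentScore [IsProbabilityMeasure P] [IsProbabilityMeasure μ] (hP : MemLp id 2 P)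
    (hmean : ∫ x, x ∂P = 0)
    (hcov : ∀ j k : Fin d, cov[fun x => x j, fun x => x k; P] = S j k)
    (hsc : HasScoreCov π S θ P)
    (hX : HasLaw X P μ) (he : HasLaw e (gaussianReal 0 (σ ^ 2).toNNReal) μ)
    (hXe : IndepFun X e μ) (a b : Fin p) :
    MemLp (fun ω => agentScore π θ S (X ω, e ω) a) 2 μ ∧
      ∫ ω, agentScore π θ S (X ω, e ω) a * agentScore π θ S (X ω, e ω) b ∂μ
        = scoreCov π S σ θ P a b := by
  obtain ⟨he2, he0, hev⟩ := he.moments_gaussianReal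
  have hA : ∀ a, MemLp (fun ω => (viewPlus π a ⬝ᵥ X ω) * (residualDir π θ S ⬝ᵥ X ω)) 2 μ :=
    fun a => hX.memLp_comp (hsc.memLp π θ a)
  have hB : ∀ a, MemLp (fun ω => (viewPlus π a ⬝ᵥ X ω) * e ω) 2 μ := fun a =>
    memLp_observed_mul_noise π hP hX he hXe a
  simp_rw [agentScore_apply]
  refine ⟨(hA a).add (hB a), ?_⟩
  -- The product formula asks only for measurability and the noise has integral zero, so the cubic
  -- feature factor needs no integrability check.
  have hcross : ∀ a b, ∫ ω, (viewPlus π a ⬝ᵥ X ω) * (residualDir π θ S ⬝ᵥ X ω) *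
      ((viewPlus π b ⬝ᵥ X ω) * e ω) ∂μ = 0 := fun a b => by
    have hm : Measurable fun x : EuclideanSpace ℝ (Fin d) =>
        (viewPlus π a ⬝ᵥ x) * (residualDir π θ S ⬝ᵥ x) * (viewPlus π b ⬝ᵥ x) :=
      ((measurable_dotProduct _).mul (measurable_dotProduct _)).mul (measurable_dotProduct _)
    have h := (hXe.comp hm measurable_id).integral_fun_mul_eq_mul_integral
      (hm.comp_aemeasurable hX.aemeasurable).aestronglyMeasurable
      he.aemeasurable.aestronglyMeasurable
    simp only [Function.comp_def, id, he0, mul_zero, mul_assoc] at h ⊢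
    exact h
  have hBB : ∫ ω, (viewPlus π a ⬝ᵥ X ω) * e ω * ((viewPlus π b ⬝ᵥ X ω) * e ω) ∂μ
      = σ ^ 2 * blockPlus π S a b := by
    have hm : Measurable fun x : EuclideanSpace ℝ (Fin d) =>
        (viewPlus π a ⬝ᵥ x) * (viewPlus π b ⬝ᵥ x) :=
      (measurable_dotProduct _).mul (measurable_dotProduct _)
    have hsq : Measurable fun y : ℝ => y ^ 2 := by fun_prop
    have h := (hXe.comp hm hsq).integral_fun_mul_eq_mul_integral
      (hm.comp_aemeasurable hX.aemeasurable).aestronglyMeasurable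
      (hsq.comp_aemeasurable he.aemeasurable).aestronglyMeasurable
    have hXX : ∫ ω, (viewPlus π a ⬝ᵥ X ω) * (viewPlus π b ⬝ᵥ X ω) ∂μ = blockPlus π S a b := by
      refine (hX.integral_comp hm.aestronglyMeasurable).trans ?_
      rw [integral_dotProduct_mul_dotProduct hP hmean hcov, viewPlus_dotProduct_mulVec]
    simp only [Function.comp_def, hXX, hev] at h
    rw [mul_comm (σ ^ 2), ← h]
    exact integral_congr_ae (ae_of_all _ fun ω => by ring)
  have hAA : ∫ ω, (viewPlus π a ⬝ᵥ X ω) * (residualDir π θ S ⬝ᵥ X ω) *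
      ((viewPlus π b ⬝ᵥ X ω) * (residualDir π θ S ⬝ᵥ X ω)) ∂μ
      = ∫ x : EuclideanSpace ℝ (Fin d), (viewPlus π *ᵥ x) a *
      ((viewMinus π *ᵥ θ) ⬝ᵥ residual π S x) ^ 2 * (viewPlus π *ᵥ x) b ∂P := by
    have hm : Measurable fun x : EuclideanSpace ℝ (Fin d) =>
        (viewPlus π a ⬝ᵥ x) * (residualDir π θ S ⬝ᵥ x) *
        ((viewPlus π b ⬝ᵥ x) * (residualDir π θ S ⬝ᵥ x)) :=
      ((measurable_dotProduct _).mul (measurable_dotProduct _)).mul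
        ((measurable_dotProduct _).mul (measurable_dotProduct _))
    refine (hX.integral_comp hm.aestronglyMeasurable).trans ?_
    refine integral_congr_ae (ae_of_all _ fun x => ?_)
    simp only [dotProduct_residual, viewPlus_mulVec_eq_dotProduct]
    ring
  have hexp : ∀ ω, ((viewPlus π a ⬝ᵥ X ω) * (residualDir π θ S ⬝ᵥ X ω)
        + (viewPlus π a ⬝ᵥ X ω) * e ω) *
      ((viewPlus π b ⬝ᵥ X ω) * (residualDir π θ S ⬝ᵥ X ω) + (viewPlus π b ⬝ᵥ X ω) * e ω)
      = (viewPlus π a ⬝ᵥ X ω) * (residualDir π θ S ⬝ᵥ X ω) *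
          ((viewPlus π b ⬝ᵥ X ω) * (residualDir π θ S ⬝ᵥ X ω))
        + (viewPlus π a ⬝ᵥ X ω) * (residualDir π θ S ⬝ᵥ X ω) * ((viewPlus π b ⬝ᵥ X ω) * e ω)
        + (viewPlus π b ⬝ᵥ X ω) * (residualDir π θ S ⬝ᵥ X ω) * ((viewPlus π a ⬝ᵥ X ω) * e ω)
        + (viewPlus π a ⬝ᵥ X ω) * e ω * ((viewPlus π b ⬝ᵥ X ω) * e ω) := fun ω => by ring
  simp_rw [hexp]
  have i1 := (hA a).integrable_mul (hA b)
  have i2 := (hA a).integrable_mul (hB b)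
  have i3 := (hA b).integrable_mul (hB a)
  have i4 := (hB a).integrable_mul (hB b)
  have s1 := integral_add i1 i2
  have s2 := integral_add (i1.add i2) i3
  have s3 := integral_add ((i1.add i2).add i3) i4
  simp only [Pi.add_apply, Pi.mul_apply] at s1 s2 s3
  rw [s3, s2, s1, hcross, hcross, hBB, hAA, add_zero, add_zero]
  simp [scoreCov]

end Agent

end Collab

/-! ### Gaussian features -/

namespace Collab

variable {d p q : ℕ} (π : Fin p ⊕ Fin q ≃ Fin d) {S : Matrix (Fin d) (Fin d) ℝ}
  (θ : EuclideanSpace ℝ (Fin d)) {P : Measure (EuclideanSpace ℝ (Fin d))}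
  [IsProbabilityMeasure P] [IsGaussian P] {σ : ℝ}

/-- For Gaussian features the residual is independent of the observed features. -/
theorem indepFun_observed_residual (hS : S.PosDef) (hP : MemLp id 2 P) (hmean : ∫ x, x ∂P = 0)
    (hcov : ∀ j k : Fin d, cov[fun x => x j, fun x => x k; P] = S j k) :
    IndepFun (fun (x : EuclideanSpace ℝ (Fin d)) a => viewPlus π a ⬝ᵥ x)
      (fun (x : EuclideanSpace ℝ (Fin d)) (_ : Unit) => residualDir π θ S ⬝ᵥ x) P := by
  -- The pair is a linear image of a Gaussian vector, hence jointly Gaussian, and zero covariances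
  -- give independence. The scalar residual is a family over `Unit` to fit the coordinatewise
  -- criterion.
  let L : EuclideanSpace ℝ (Fin d) →ₗ[ℝ] (Fin p → ℝ) × (Unit → ℝ) :=
    { toFun := fun x => (fun a => viewPlus π a ⬝ᵥ x, fun _ => residualDir π θ S ⬝ᵥ x)
      map_add' := fun x y => by ext <;> simp [dotProduct_add]
      map_smul' := fun c x => by ext <;> simp [dotProduct_smul] }
  have hL : HasGaussianLaw (fun x : EuclideanSpace ℝ (Fin d) =>
      ((fun a => viewPlus π a ⬝ᵥ x : Fin p → ℝ),
        (fun _ => residualDir π θ S ⬝ᵥ x : Unit → ℝ))) P :=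
    (IsGaussian.hasGaussianLaw_id (μ := P)).map_fun L.toContinuousLinearMap
  refine hL.indepFun_of_covariance_eval fun a _ => ?_
  have h := covariance_eq_sub (memLp_dotProduct hP (viewPlus π a))
    (memLp_dotProduct hP (residualDir π θ S))
  rw [h, integral_dotProduct hP hmean, zero_mul, sub_zero]
  refine (integral_dotProduct_mul_dotProduct hP hmean hcov _ _).trans ?_
  exact congrFun (viewPlus_mul_residualDir π θ hS) a

/-- By independence the fourth-order moment factors into two second moments. -/
theorem hasScoreCov_of_isGaussian (hS : S.PosDef) (hP : MemLp id 2 P) (hmean : ∫ x, x ∂P = 0)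
    (hcov : ∀ j k : Fin d, cov[fun x => x j, fun x => x k; P] = S j k) :
    HasScoreCov π S θ P := by
  have hf : Measurable fun v : Fin p → ℝ => v ⬝ᵥ v := by
    simp only [dotProduct]
    fun_prop
  have hg : Measurable fun v : Unit → ℝ => v () ^ 2 := by fun_prop
  have hobs : Integrable (fun x : EuclideanSpace ℝ (Fin d) =>
      ∑ a, (viewPlus π a ⬝ᵥ x) * (viewPlus π a ⬝ᵥ x)) P :=
    integrable_finsetSum _ fun a _ =>
      (memLp_dotProduct hP (viewPlus π a)).integrable_mul (memLp_dotProduct hP (viewPlus π a))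
  have h := ((indepFun_observed_residual π θ hS hP hmean hcov).comp hf hg).integrable_mul hobs
    (memLp_dotProduct hP (residualDir π θ S)).integrable_sq
  refine h.congr (ae_of_all _ fun x => ?_)
  simp only [dotProduct_residual]
  rfl

theorem scoreCov_of_isGaussian (hS : S.PosDef) (hP : MemLp id 2 P) (hmean : ∫ x, x ∂P = 0)
    (hcov : ∀ j k : Fin d, cov[fun x => x j, fun x => x k; P] = S j k) :
    scoreCov π S σ θ P = residualVar π S σ θ • blockPlus π S := by
  rw [scoreCov, residualVar, add_smul]
  congr 1
  ext a b
  have hf : Measurable fun v : Fin p → ℝ => v a * v b := by fun_prop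
  have hg : Measurable fun v : Unit → ℝ => v () ^ 2 := by fun_prop
  have h := ((indepFun_observed_residual π θ hS hP hmean hcov).comp hf
    hg).integral_fun_mul_eq_mul_integral
    ((measurable_dotProduct _).mul (measurable_dotProduct _)).aestronglyMeasurable
    ((measurable_dotProduct _).pow_const 2).aestronglyMeasurable
  simp only [Function.comp_def, sq] at h
  rw [integral_dotProduct_mul_dotProduct hP hmean hcov,
    integral_dotProduct_mul_dotProduct hP hmean hcov, viewPlus_dotProduct_mulVec,
    residualDir_quadForm π θ hS] at h
  rw [Matrix.of_apply, Matrix.smul_apply, smul_eq_mul, mul_comm (quadForm _ _), ← h]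
  refine integral_congr_ae (ae_of_all _ fun x => ?_)
  simp only [dotProduct_residual, viewPlus_mulVec_eq_dotProduct]
  ring

end Collab

/-! ### The estimator as a random linear system, and its moments -/

namespace Collab

section Algebra

variable {m d : ℕ} {r : Fin m → ℕ} (π : ∀ i, Fin (r i) ⊕ Fin (d - r i) ≃ Fin d)
  (S : Matrix (Fin d) (Fin d) ℝ) (θ : EuclideanSpace ℝ (Fin d)) (α : Fin m → ℝ)

/-- The contribution of one sample per agent to the normal matrix of the estimator. -/
noncomputable def sampleGram (w : Fin m → EuclideanSpace ℝ (Fin d) × ℝ) :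
    Matrix (Fin d) (Fin d) ℝ :=
  ∑ i, α i • ((imputeMat (π i) S)ᵀ *
    Matrix.vecMulVec (viewPlus (π i) *ᵥ (w i).1) (viewPlus (π i) *ᵥ (w i).1) * imputeMat (π i) S)

/-- The contribution of one sample per agent to the score of the estimator. -/
noncomputable def sampleScore (w : Fin m → EuclideanSpace ℝ (Fin d) × ℝ) :
    EuclideanSpace ℝ (Fin d) :=
  WithLp.toLp 2 (∑ i, α i • ((imputeMat (π i) S)ᵀ *ᵥ agentScore (π i) θ S (w i)))

theorem designMat_mul_viewPlus_transpose {p q : ℕ} (π : Fin p ⊕ Fin q ≃ Fin d) (n : ℕ)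
    (x : ℕ → EuclideanSpace ℝ (Fin d)) (k : Fin n) (a : Fin p) :
    (designMat n x * (viewPlus π)ᵀ) k a = (viewPlus π *ᵥ x k) a := by
  simp [designMat, Matrix.mul_apply, Matrix.mulVec, dotProduct, mul_comm]

theorem transpose_observed_mul_observed {p q : ℕ} (π : Fin p ⊕ Fin q ≃ Fin d) (n : ℕ)
    (x : ℕ → EuclideanSpace ℝ (Fin d)) :
    (designMat n x * (viewPlus π)ᵀ)ᵀ * (designMat n x * (viewPlus π)ᵀ)
      = ∑ k ∈ Finset.range n, Matrix.vecMulVec (viewPlus π *ᵥ x k) (viewPlus π *ᵥ x k) := by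
  ext a b
  rw [Matrix.mul_apply, Matrix.sum_apply, Finset.sum_range]
  refine Finset.sum_congr rfl fun k _ => ?_
  rw [Matrix.transpose_apply, designMat_mul_viewPlus_transpose, designMat_mul_viewPlus_transpose,
    Matrix.vecMulVec_apply]

theorem transpose_observed_mulVec_residual {p q : ℕ} (π : Fin p ⊕ Fin q ≃ Fin d) (n : ℕ)
    (x : ℕ → EuclideanSpace ℝ (Fin d)) (ε : ℕ → ℝ) :
    (designMat n x * (viewPlus π)ᵀ)ᵀ *ᵥ
        (designMat n x *ᵥ residualDir π θ S + fun k : Fin n => ε k)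
      = ∑ k ∈ Finset.range n, agentScore π θ S (x k, ε k) := by
  ext a
  rw [Finset.sum_apply, Finset.sum_range]
  simp only [Matrix.mulVec, dotProduct]
  refine Finset.sum_congr rfl fun k _ => ?_
  rw [Matrix.transpose_apply, designMat_mul_viewPlus_transpose, agentScore, Pi.smul_apply,
    smul_eq_mul, mul_comm]
  simp [Matrix.mulVec, dotProduct, designMat, mul_comm]

variable {S}

/-- Substituting `X θ = X₊ T θ + X g` into the labels separates the normal matrix times `θ` from the
score. Both sides use the same inverse, so singular matrices need no separate case. -/
theorem impGlbEstimator_eq_linearSolve (hS : S.PosDef) (n : ℕ)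
    (x : Fin m → ℕ → EuclideanSpace ℝ (Fin d)) (ε : Fin m → ℕ → ℝ) :
    impGlbEstimator π S θ α n x ε
      = linearSolve θ (∑ k ∈ Finset.range n, sampleGram π S α fun i => (x i k, ε i k))
        (∑ k ∈ Finset.range n, sampleScore π S θ α fun i => (x i k, ε i k)) := by
  have hgram : ∀ i, (imputeMat (π i) S)ᵀ * (designMat n (x i) * (viewPlus (π i))ᵀ)ᵀ *
      (designMat n (x i) * (viewPlus (π i))ᵀ) * imputeMat (π i) S
      = ∑ k ∈ Finset.range n, (imputeMat (π i) S)ᵀ * Matrix.vecMulVec (viewPlus (π i) *ᵥ x i k)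
        (viewPlus (π i) *ᵥ x i k) * imputeMat (π i) S := fun i => by
    rw [Matrix.mul_assoc (imputeMat (π i) S)ᵀ, transpose_observed_mul_observed, Matrix.mul_sum,
      Matrix.sum_mul]
  have hrhs : ∀ i, ((imputeMat (π i) S)ᵀ * (designMat n (x i) * (viewPlus (π i))ᵀ)ᵀ) *ᵥ
      (designMat n (x i) *ᵥ θ + fun k : Fin n => ε i k)
      = ((imputeMat (π i) S)ᵀ * (designMat n (x i) * (viewPlus (π i))ᵀ)ᵀ *
        (designMat n (x i) * (viewPlus (π i))ᵀ) * imputeMat (π i) S) *ᵥ θ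
        + (imputeMat (π i) S)ᵀ *ᵥ ∑ k ∈ Finset.range n,
          agentScore (π i) θ S (x i k, ε i k) := fun i => by
    rw [← transpose_observed_mulVec_residual]
    -- Only the `θ` inside the labels is split.
    nth_rw 1 [← transpose_mulVec_imputeMat_add_residualDir (π i) θ hS]
    simp only [Matrix.mulVec_add, Matrix.mulVec_mulVec, Matrix.mul_assoc]
    abel
  rw [impGlbEstimator, impGlb, linearSolve]
  have hA : ∑ i, α i • ((imputeMat (π i) S)ᵀ * (designMat n (x i) * (viewPlus (π i))ᵀ)ᵀ *
      (designMat n (x i) * (viewPlus (π i))ᵀ) * imputeMat (π i) S)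
      = ∑ k ∈ Finset.range n, sampleGram π S α fun i => (x i k, ε i k) := by
    simp only [hgram, sampleGram, Finset.smul_sum]
    rw [Finset.sum_comm]
  have hb : ∑ i, α i • ((imputeMat (π i) S)ᵀ *ᵥ ∑ k ∈ Finset.range n,
      agentScore (π i) θ S (x i k, ε i k))
      = ((∑ k ∈ Finset.range n, sampleScore π S θ α fun i => (x i k, ε i k) :
        EuclideanSpace ℝ (Fin d)) : Fin d → ℝ) := by
    simp only [Matrix.mulVec_sum, Finset.smul_sum, sampleScore, WithLp.ofLp_sum]
    rw [Finset.sum_comm]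
  simp only [hrhs, smul_add, Finset.sum_add_distrib, hb]
  rw [← hA, Matrix.sum_mulVec]
  simp only [Matrix.smul_mulVec]

theorem measurable_agentScore {p q : ℕ} (π : Fin p ⊕ Fin q ≃ Fin d) (a : Fin p) :
    Measurable fun w : EuclideanSpace ℝ (Fin d) × ℝ => agentScore π θ S w a := by
  simp only [agentScore_apply]
  exact (((measurable_dotProduct _).comp measurable_fst).mul
    ((measurable_dotProduct _).comp measurable_fst)).add
    (((measurable_dotProduct _).comp measurable_fst).mul measurable_snd)

theorem sampleScore_apply (w : Fin m → EuclideanSpace ℝ (Fin d) × ℝ) (j : Fin d) :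
    sampleScore π S θ α w j
      = ∑ i, ∑ a, α i * imputeMat (π i) S a j * agentScore (π i) θ S (w i) a := by
  simp [sampleScore, Finset.sum_apply, Matrix.mulVec, dotProduct, Finset.mul_sum, mul_assoc]

theorem measurable_sampleScore : Measurable (sampleScore π S θ α) := by
  refine (WithLp.measurable_toLp 2 _).comp (measurable_pi_lambda _ fun j => ?_)
  have h : Measurable fun w => sampleScore π S θ α w j := by
    simp only [sampleScore_apply]
    exact Finset.measurable_fun_sum _ fun i _ => Finset.measurable_fun_sum _ fun a _ =>
      ((measurable_agentScore θ (π i) a).comp (measurable_pi_apply i)).const_mul _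
  exact h

theorem sampleGram_apply (w : Fin m → EuclideanSpace ℝ (Fin d) × ℝ) (j l : Fin d) :
    sampleGram π S α w j l = ∑ i, ∑ b, ∑ a, α i * imputeMat (π i) S a j * imputeMat (π i) S b l *
      ((viewPlus (π i) a ⬝ᵥ (w i).1) * (viewPlus (π i) b ⬝ᵥ (w i).1)) := by
  simp only [sampleGram, Matrix.sum_apply, Matrix.smul_apply, Matrix.mul_apply, smul_eq_mul,
    Matrix.vecMulVec_apply, Matrix.transpose_apply, viewPlus_mulVec_eq_dotProduct, Finset.mul_sum,
    Finset.sum_mul]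
  refine Finset.sum_congr rfl fun i _ => Finset.sum_congr rfl fun b _ =>
    Finset.sum_congr rfl fun a _ => by ring

theorem measurable_sampleGram (j l : Fin d) : Measurable fun w => sampleGram π S α w j l := by
  simp only [sampleGram_apply]
  exact Finset.measurable_fun_sum _ fun i _ => Finset.measurable_fun_sum _ fun b _ =>
    Finset.measurable_fun_sum _ fun a _ =>
      (((measurable_dotProduct _).comp (measurable_fst.comp (measurable_pi_apply i))).mul
        ((measurable_dotProduct _).comp
          (measurable_fst.comp (measurable_pi_apply i)))).const_mul _

end Algebra

section Moments

variable {m d : ℕ} {r : Fin m → ℕ} (π : ∀ i, Fin (r i) ⊕ Fin (d - r i) ≃ Fin d)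
  {S : Matrix (Fin d) (Fin d) ℝ} {θ : EuclideanSpace ℝ (Fin d)} {σ : ℝ} (α : Fin m → ℝ)
  {P : Measure (EuclideanSpace ℝ (Fin d))} [IsProbabilityMeasure P]
  {Ω : Type*} [MeasurableSpace Ω] {μ : Measure Ω}
  {X : Fin m → Ω → EuclideanSpace ℝ (Fin d)} {e : Fin m → Ω → ℝ}

theorem integral_sampleGram (hP : MemLp id 2 P) (hmean : ∫ x, x ∂P = 0)
    (hcov : ∀ j k : Fin d, cov[fun x => x j, fun x => x k; P] = S j k)
    (hX : ∀ i, HasLaw (X i) P μ) (j l : Fin d) :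
    Integrable (fun ω => sampleGram π S α (fun i => (X i ω, e i ω)) j l) μ ∧
      ∫ ω, sampleGram π S α (fun i => (X i ω, e i ω)) j l ∂μ
      = (∑ i, α i • ((imputeMat (π i) S)ᵀ * blockPlus (π i) S * imputeMat (π i) S)) j l := by
  have hint : ∀ i a b, Integrable (fun ω => α i * imputeMat (π i) S a j * imputeMat (π i) S b l *
      ((viewPlus (π i) a ⬝ᵥ X i ω) * (viewPlus (π i) b ⬝ᵥ X i ω))) μ := fun i a b =>
    (((hX i).memLp_comp (memLp_dotProduct hP _)).integrable_mul
      ((hX i).memLp_comp (memLp_dotProduct hP _))).const_mul _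
  have hval : ∀ i a b, ∫ ω, (viewPlus (π i) a ⬝ᵥ X i ω) * (viewPlus (π i) b ⬝ᵥ X i ω) ∂μ
      = blockPlus (π i) S a b := fun i a b => by
    refine ((hX i).integral_comp (f := fun x : EuclideanSpace ℝ (Fin d) =>
      (viewPlus (π i) a ⬝ᵥ x) * (viewPlus (π i) b ⬝ᵥ x))
      ((measurable_dotProduct _).mul (measurable_dotProduct _)).aestronglyMeasurable).trans ?_
    rw [integral_dotProduct_mul_dotProduct hP hmean hcov, viewPlus_dotProduct_mulVec]
  simp only [sampleGram_apply]
  refine ⟨integrable_finsetSum _ fun i _ => integrable_finsetSum _ fun b _ =>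
    integrable_finsetSum _ fun a _ => hint i a b, ?_⟩
  rw [integral_finsetSum _ fun i _ => integrable_finsetSum _ fun b _ =>
    integrable_finsetSum _ fun a _ => hint i a b, Matrix.sum_apply]
  refine Finset.sum_congr rfl fun i _ => ?_
  rw [integral_finsetSum _ fun b _ => integrable_finsetSum _ fun a _ => hint i a b,
    Matrix.smul_apply, Matrix.mul_apply, smul_eq_mul, Finset.mul_sum]
  refine Finset.sum_congr rfl fun b _ => ?_
  rw [integral_finsetSum _ fun a _ => hint i a b, Matrix.mul_apply, Finset.sum_mul, Finset.mul_sum]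
  refine Finset.sum_congr rfl fun a _ => ?_
  rw [integral_const_mul, hval, Matrix.transpose_apply]
  ring

theorem integral_sampleScore [IsProbabilityMeasure μ] (hS : S.PosDef) (hP : MemLp id 2 P) (hmean : ∫ x, x ∂P = 0)
    (hcov : ∀ j k : Fin d, cov[fun x => x j, fun x => x k; P] = S j k)
    (hX : ∀ i, HasLaw (X i) P μ) (he : ∀ i, HasLaw (e i) (gaussianReal 0 (σ ^ 2).toNNReal) μ)
    (hXe : ∀ i, IndepFun (X i) (e i) μ) (j : Fin d) :
    Integrable (fun ω => sampleScore π S θ α (fun i => (X i ω, e i ω)) j) μ ∧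
      ∫ ω, sampleScore π S θ α (fun i => (X i ω, e i ω)) j ∂μ = 0 := by
  have h := fun i a =>
    integral_agentScore (π i) θ hS hP hmean hcov (hX i) (he i) (hXe i) a
  simp only [sampleScore_apply]
  refine ⟨integrable_finsetSum _ fun i _ => integrable_finsetSum _ fun a _ =>
    (h i a).1.const_mul _, ?_⟩
  rw [integral_finsetSum _ fun i _ => integrable_finsetSum _ fun a _ => (h i a).1.const_mul _]
  refine Finset.sum_eq_zero fun i _ => ?_
  rw [integral_finsetSum _ fun a _ => (h i a).1.const_mul _]
  refine Finset.sum_eq_zero fun a _ => ?_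
  rw [integral_const_mul, (h i a).2, mul_zero]

/-- Scores of different agents are independent and centred, so only the diagonal terms survive. -/
theorem second_moment_sampleScore [IsProbabilityMeasure μ] (hS : S.PosDef) (hP : MemLp id 2 P) (hmean : ∫ x, x ∂P = 0)
    (hcov : ∀ j k : Fin d, cov[fun x => x j, fun x => x k; P] = S j k)
    (hsc : ∀ i, HasScoreCov (π i) S θ P)
    (hX : ∀ i, HasLaw (X i) P μ) (he : ∀ i, HasLaw (e i) (gaussianReal 0 (σ ^ 2).toNNReal) μ)
    (hXe : ∀ i, IndepFun (X i) (e i) μ)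
    (hindep : iIndepFun (fun i ω => (X i ω, e i ω)) μ) (j l : Fin d) :
    MemLp (fun ω => sampleScore π S θ α (fun i => (X i ω, e i ω)) j) 2 μ ∧
      ∫ ω, sampleScore π S θ α (fun i => (X i ω, e i ω)) j *
          sampleScore π S θ α (fun i => (X i ω, e i ω)) l ∂μ
        = (∑ i, α i ^ 2 • ((imputeMat (π i) S)ᵀ * scoreCov (π i) S σ θ P *
          imputeMat (π i) S)) j l := by
  have h1 := fun i a =>
    integral_agentScore (π i) θ hS hP hmean hcov (hX i) (he i) (hXe i) a
  have h2 := fun i a b =>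
    second_moment_agentScore (π i) θ hP hmean hcov (hsc i) (hX i) (he i) (hXe i) a b
  have hmem : ∀ i a, MemLp (fun ω => agentScore (π i) θ S (X i ω, e i ω) a) 2 μ :=
    fun i a => (h2 i a a).1
  simp only [sampleScore_apply]
  refine ⟨memLp_finsetSum _ fun i _ => memLp_finsetSum _ fun a _ => (hmem i a).const_mul _, ?_⟩
  let f : ∀ i : Fin m, Fin d → EuclideanSpace ℝ (Fin d) × ℝ → ℝ := fun i j w =>
    ∑ a, α i * imputeMat (π i) S a j * agentScore (π i) θ S w a
  have hfm : ∀ i j, Measurable (f i j) := fun i j =>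
    Finset.measurable_fun_sum _ fun a _ => (measurable_agentScore θ (π i) a).const_mul _
  have hf2 : ∀ i j, MemLp (fun ω => f i j (X i ω, e i ω)) 2 μ := fun i j =>
    memLp_finsetSum _ fun a _ => (hmem i a).const_mul _
  have hf0 : ∀ i j, ∫ ω, f i j (X i ω, e i ω) ∂μ = 0 := fun i j => by
    simp only [f]
    rw [integral_finsetSum _ fun a _ => (h1 i a).1.const_mul _]
    simp [integral_const_mul, (h1 i _).2]
  have hoff : ∀ i i', i ≠ i' → ∫ ω, f i j (X i ω, e i ω) * f i' l (X i' ω, e i' ω) ∂μ = 0 :=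
    fun i i' hii => by
      have h := ((hindep.indepFun hii).comp (hfm i j)
        (hfm i' l)).integral_fun_mul_eq_mul_integral (hf2 i j).1 (hf2 i' l).1
      refine h.trans ?_
      simp only [Function.comp_def, hf0, mul_zero]
  have hint : ∀ i i', Integrable (fun ω => f i j (X i ω, e i ω) * f i' l (X i' ω, e i' ω)) μ :=
    fun i i' => (hf2 i j).integrable_mul (hf2 i' l)
  have hdiag : ∀ i, ∫ ω, f i j (X i ω, e i ω) * f i l (X i ω, e i ω) ∂μ
      = (α i ^ 2 • ((imputeMat (π i) S)ᵀ * scoreCov (π i) S σ θ P * imputeMat (π i) S)) j l :=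
    fun i => by
      have hi : ∀ a b, Integrable (fun ω =>
          α i * imputeMat (π i) S a j * agentScore (π i) θ S (X i ω, e i ω) a *
          (α i * imputeMat (π i) S b l * agentScore (π i) θ S (X i ω, e i ω) b)) μ := fun a b =>
        ((hmem i a).const_mul _).integrable_mul ((hmem i b).const_mul _)
      simp only [f, Finset.sum_mul_sum]
      rw [integral_finsetSum _ fun a _ => integrable_finsetSum _ fun b _ => hi a b,
        Matrix.smul_apply, Matrix.mul_apply, smul_eq_mul, Finset.mul_sum]
      simp_rw [integral_finsetSum _ fun b _ => hi _ b]
      rw [Finset.sum_comm]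
      refine Finset.sum_congr rfl fun b _ => ?_
      rw [Matrix.mul_apply, Finset.sum_mul, Finset.mul_sum]
      refine Finset.sum_congr rfl fun a _ => ?_
      simp_rw [mul_mul_mul_comm (α i * imputeMat (π i) S a j)]
      rw [integral_const_mul, (h2 i a b).2, Matrix.transpose_apply]
      ring
  change ∫ ω, (∑ i, f i j (X i ω, e i ω)) * (∑ i, f i l (X i ω, e i ω)) ∂μ = _
  simp only [Finset.sum_mul_sum]
  rw [integral_finsetSum _ fun i _ => integrable_finsetSum _ fun i' _ => hint i i',
    Matrix.sum_apply]
  refine Finset.sum_congr rfl fun i _ => ?_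
  rw [integral_finsetSum _ fun i' _ => hint i i',
    Finset.sum_eq_single i (fun i' _ hi' => hoff i i' hi'.symm) (by simp), hdiag]

end Moments

end Collab

/-! ### Laws of large numbers and covariances under proportional `Q` -/

namespace Collab

section Samples

variable {d : ℕ} {Ω E : Type*} [MeasurableSpace Ω] [MeasurableSpace E] {μ : Measure Ω}
  {W : ℕ → Ω → E}

/-- The strong law of large numbers for random matrices. -/
theorem strong_law_matrix (hW : iIndepFun W μ) (hident : ∀ k, IdentDistrib (W k) (W 0) μ μ)
    {G : E → Matrix (Fin d) (Fin d) ℝ} {H : Matrix (Fin d) (Fin d) ℝ}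
    (hG : ∀ j l, Measurable fun w => G w j l)
    (hH : ∀ j l, Integrable (fun ω => G (W 0 ω) j l) μ ∧ ∫ ω, G (W 0 ω) j l ∂μ = H j l) :
    ∀ᵐ ω ∂μ, Tendsto (fun n : ℕ => (n : ℝ)⁻¹ • ∑ k ∈ Finset.range n, G (W k ω)) atTop (𝓝 H) := by
  have hjl : ∀ j l, ∀ᵐ ω ∂μ, Tendsto
      (fun n : ℕ => (n : ℝ)⁻¹ • ∑ k ∈ Finset.range n, G (W k ω) j l) atTop (𝓝 (H j l)) :=
    fun j l => by
      have h := strong_law_ae (fun k ω => G (W k ω) j l) (hH j l).1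
        (fun k k' hk => (hW.indepFun hk).comp (hG j l) (hG j l))
        fun k => (hident k).comp (hG j l)
      rwa [(hH j l).2] at h
  filter_upwards [ae_all_iff.2 fun j => ae_all_iff.2 (hjl j)] with ω hω
  refine tendsto_pi_nhds.2 fun j => tendsto_pi_nhds.2 fun l => ?_
  refine (hω j l).congr fun n => ?_
  rw [Matrix.smul_apply, Matrix.sum_apply]

theorem strong_law_centred (hW : iIndepFun W μ) (hident : ∀ k, IdentDistrib (W k) (W 0) μ μ)
    {s : E → EuclideanSpace ℝ (Fin d)} (hs : Measurable s)
    (h0 : ∀ j, Integrable (fun ω => s (W 0 ω) j) μ ∧ ∫ ω, s (W 0 ω) j ∂μ = 0) :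
    ∀ᵐ ω ∂μ, Tendsto (fun n : ℕ => (n : ℝ)⁻¹ • ∑ k ∈ Finset.range n, s (W k ω)) atTop (𝓝 0) := by
  have h := strong_law_ae (fun k ω => s (W k ω)) (integrable_piLp_iff.2 fun j => (h0 j).1)
    (fun k k' hk => (hW.indepFun hk).comp hs hs) fun k => (hident k).comp hs
  have hz : ∫ ω, s (W 0 ω) ∂μ = 0 := by
    ext j
    rw [eval_integral_piLp fun j => (h0 j).1, (h0 j).2, PiLp.zero_apply]
  rwa [hz] at h

end Samples

section Agents

variable {m d : ℕ} {r : Fin m → ℕ} (π : ∀ i, Fin (r i) ⊕ Fin (d - r i) ≃ Fin d)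
  {S : Matrix (Fin d) (Fin d) ℝ}

/-- When `Q = c Σ₊`, the weight `Σ₊ Q⁻¹ Σ₊` collapses to `c⁻¹ Σ₊`. -/
theorem optCov_eq (θ : EuclideanSpace ℝ (Fin d)) (σ : ℝ) (P : Measure (EuclideanSpace ℝ (Fin d)))
    (hS : S.PosDef)
    (hQ : ∀ i, scoreCov (π i) S σ θ P = residualVar (π i) S σ θ • blockPlus (π i) S)
    (hres : ∀ i, 0 < residualVar (π i) S σ θ) :
    optCov π S σ θ P = (∑ i, (residualVar (π i) S σ θ)⁻¹ •
      ((imputeMat (π i) S)ᵀ * blockPlus (π i) S * imputeMat (π i) S))⁻¹ := by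
  have hinv : ∀ i, (residualVar (π i) S σ θ • blockPlus (π i) S)⁻¹
      = (residualVar (π i) S σ θ)⁻¹ • (blockPlus (π i) S)⁻¹ := fun i =>
    Matrix.inv_eq_right_inv <| by
      rw [Matrix.smul_mul, Matrix.mul_smul, smul_smul, mul_inv_cancel₀ (hres i).ne', one_smul,
        Matrix.mul_nonsing_inv _ (isUnit_det_blockPlus _ hS)]
  rw [optCov]
  congr 1
  refine Finset.sum_congr rfl fun i _ => ?_
  rw [optWeight, hQ, hinv, Matrix.mul_smul, Matrix.mul_nonsing_inv _ (isUnit_det_blockPlus _ hS),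
    Matrix.smul_mul, Matrix.one_mul, Matrix.mul_smul, Matrix.smul_mul]

theorem impGlbCov_eq (θ : EuclideanSpace ℝ (Fin d)) (σ : ℝ)
    (P : Measure (EuclideanSpace ℝ (Fin d))) (α : Fin m → ℝ)
    (hQ : ∀ i, scoreCov (π i) S σ θ P = residualVar (π i) S σ θ • blockPlus (π i) S) :
    impGlbCov π S σ θ P α =
      (∑ i, α i • ((imputeMat (π i) S)ᵀ * blockPlus (π i) S * imputeMat (π i) S))⁻¹ *
      (∑ i, α i ^ 2 • residualVar (π i) S σ θ •
        ((imputeMat (π i) S)ᵀ * blockPlus (π i) S * imputeMat (π i) S)) *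
      (∑ i, α i • ((imputeMat (π i) S)ᵀ * blockPlus (π i) S * imputeMat (π i) S))⁻¹ := by
  simp only [impGlbCov, hQ, Matrix.mul_smul, Matrix.smul_mul]

end Agents

end Collab

theorem mainTheorem5 {m d : ℕ} (r : Fin m → ℕ)
    (π : ∀ i, Fin (r i) ⊕ Fin (d - r i) ≃ Fin d)
    -- every feature is observed by some agent
    (hcover : ∀ j : Fin d, ∃ (i : Fin m) (a : Fin (r i)), π i (Sum.inl a) = j)
    (θ : EuclideanSpace ℝ (Fin d)) (σ : ℝ)
    -- the law of a feature vector: mean zero, covariance `S` positive definite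
    (P : Measure (EuclideanSpace ℝ (Fin d))) [IsProbabilityMeasure P]
    (S : Matrix (Fin d) (Fin d) ℝ) (hS : S.PosDef)
    (hP : MemLp id 2 P) (hmean : ∫ x, x ∂P = 0)
    (hcov : ∀ j k : Fin d, cov[fun x => x j, fun x => x k; P] = S j k)
    -- the data
    {Ω : Type*} [MeasurableSpace Ω] (μ : Measure Ω) [IsProbabilityMeasure μ]
    (x : Fin m → ℕ → Ω → EuclideanSpace ℝ (Fin d)) (ε : Fin m → ℕ → Ω → ℝ)
    (hx : ∀ i k, HasLaw (x i k) P μ)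
    (hε : ∀ i k, HasLaw (ε i k) (gaussianReal 0 (σ ^ 2).toNNReal) μ)
    (hxε : ∀ i k, IndepFun (x i k) (ε i k) μ)
    (hindep : iIndepFun (fun (s : Fin m × ℕ) ω => (x s.1 s.2 ω, ε s.1 s.2 ω)) μ) :
    -- consistency
    (∀ α : Fin m → ℝ, (∀ i, 0 < α i) →
      TendstoInMeasure μ
        (fun n ω => Collab.impGlbEstimator π S θ α n (fun i k => x i k ω) (fun i k => ε i k ω))
        atTop (fun _ => θ)) ∧
    -- asymptotic normality
    ((∀ i, Collab.HasScoreCov (π i) S θ P) →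
      ∀ α : Fin m → ℝ, (∀ i, 0 < α i) →
        (Collab.impGlbCov π S σ θ P α).PosSemidef ∧
        TendstoInDistribution
          (fun (n : ℕ) ω => √(n : ℝ) •
            (Collab.impGlbEstimator π S θ α n (fun i k => x i k ω) (fun i k => ε i k ω) - θ))
          atTop id (fun _ => μ) (multivariateGaussian 0 (Collab.impGlbCov π S σ θ P α))) ∧
    -- Gaussian features
    (P = multivariateGaussian 0 S →
      (∀ i, Collab.HasScoreCov (π i) S θ P) ∧
      ((∀ i, 0 < Collab.residualVar (π i) S σ θ) →
        (∀ α : Fin m → ℝ, (∀ i, 0 < α i) →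
          (Collab.impGlbCov π S σ θ P α - Collab.optCov π S σ θ P).PosSemidef) ∧
        Collab.impGlbCov π S σ θ P (fun i => 1 / Collab.residualVar (π i) S σ θ) =
          Collab.optCov π S σ θ P)) := by
  -- The `k`-th samples of all agents are bundled into one variable, which makes the data a single
  -- i.i.d. sequence indexed by `k`.
  let W : ℕ → Ω → Fin m → EuclideanSpace ℝ (Fin d) × ℝ := fun k ω i => (x i k ω, ε i k ω)
  have hpair : ∀ p : ℕ × Fin m, AEMeasurable (fun ω => (x p.2 p.1 ω, ε p.2 p.1 ω)) μ :=
    fun p => (hx p.2 p.1).aemeasurable.prodMk (hε p.2 p.1).aemeasurable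
  have hswap : iIndepFun (fun (p : ℕ × Fin m) ω => (x p.2 p.1 ω, ε p.2 p.1 ω)) μ :=
    hindep.precomp (g := Prod.swap) Prod.swap_injective
  have hW : iIndepFun W μ := hswap.curry hpair
  have hrow : ∀ k, iIndepFun (fun i ω => (x i k ω, ε i k ω)) μ := fun k =>
    hindep.precomp (g := fun i => (i, k)) (Prod.mk_left_injective k)
  have hident : ∀ k, IdentDistrib (W k) (W 0) μ μ := fun k =>
    (hrow k).identDistrib_pi (hrow 0) fun i => (hx i k).identDistrib (hx i 0) |>.prodMk
      ((hε i k).identDistrib (hε i 0)) (hxε i k) (hxε i 0)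
  have hGm := fun α => Collab.measurable_sampleGram π (S := S) α
  have hsm := fun α => Collab.measurable_sampleScore π (S := S) θ α
  have hAm : ∀ (α : Fin m → ℝ) (n : ℕ) j l, AEMeasurable
      (fun ω => (∑ k ∈ Finset.range n, Collab.sampleGram π S α (W k ω)) j l) μ :=
    fun α n j l => by
      simp only [Matrix.sum_apply]
      exact Finset.aemeasurable_fun_sum _ fun k _ =>
        (hGm α j l).comp_aemeasurable (hident k).aemeasurable_fst
  have hum : ∀ (α : Fin m → ℝ) (n : ℕ), AEMeasurable
      (fun ω => ∑ k ∈ Finset.range n, Collab.sampleScore π S θ α (W k ω)) μ := fun α n =>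
    Finset.aemeasurable_fun_sum _ fun k _ => (hsm α).comp_aemeasurable (hident k).aemeasurable_fst
  have hgram := fun α => Collab.strong_law_matrix hW hident (hGm α)
    (Collab.integral_sampleGram π α (e := fun i => ε i 0) hP hmean hcov fun i => hx i 0)
  have hscore := fun α => Collab.integral_sampleScore π (θ := θ) α hS hP hmean hcov
    (fun i => hx i 0) (fun i => hε i 0) fun i => hxε i 0
  have hH := fun (α : Fin m → ℝ) (hα : ∀ i, 0 < α i) => Collab.sum_smul_posDef π hcover hS hα
  refine ⟨fun α hα => ?_, fun hsc α hα => ?_, fun hPG => ?_⟩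
  · simp only [Collab.impGlbEstimator_eq_linearSolve π θ α hS]
    exact Collab.tendstoInMeasure_linearSolve (hAm α) (hum α) (hgram α) (hH α hα).det_pos.ne'
      (Collab.strong_law_centred hW hident (hsm α) (hscore α))
  · have hsecond := Collab.second_moment_sampleScore π α hS hP hmean hcov hsc
      (fun i => hx i 0) (fun i => hε i 0) (fun i => hxε i 0) (hrow 0)
    have hM := (Collab.posSemidef_of_second_moment (fun j => (hsecond j j).1)
      (fun j l => (hsecond j l).2) 0).2
    have hclt := Collab.tendstoInDistribution_multivariateGaussian
      (hW.comp (fun _ => Collab.sampleScore π S θ α) fun _ => hsm α)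
      (fun k => (hident k).comp (hsm α)) (fun j => (hsecond j j).1) (fun j => (hscore α j).2)
      fun j l => (hsecond j l).2
    -- Symmetry of `H⁻¹` turns `H⁻¹ M (H⁻¹)ᵀ` into `impGlbCov`.
    have hHt := Collab.transpose_eq_of_posDef (hH α hα).inv
    have hC : (Collab.impGlbCov π S σ θ P α).PosSemidef := by
      have h := hM.mul_mul_conjTranspose_same (∑ i, α i • ((Collab.imputeMat (π i) S)ᵀ *
        Collab.blockPlus (π i) S * Collab.imputeMat (π i) S))⁻¹
      rwa [Matrix.conjTranspose_eq_transpose_of_trivial, hHt] at h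
    refine ⟨hC, ?_⟩
    simp only [Collab.impGlbEstimator_eq_linearSolve π θ α hS]
    have h := Collab.tendstoInDistribution_linearSolve (θ := θ) (hAm α) (hum α) (hgram α)
      (hH α hα).det_pos.ne' hM hclt
    rw [hHt] at h
    exact h
  · have hG : IsGaussian P := hPG ▸ inferInstance
    refine ⟨fun i => Collab.hasScoreCov_of_isGaussian (π i) θ hS hP hmean hcov, fun hres => ?_⟩
    have hQ := fun i => Collab.scoreCov_of_isGaussian (σ := σ) (π i) θ hS hP hmean hcov
    have hN := hH (fun i => (Collab.residualVar (π i) S σ θ)⁻¹) fun i => inv_pos.2 (hres i)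
    rw [Collab.optCov_eq π θ σ P hS hQ hres]
    refine ⟨fun α hα => ?_, ?_⟩
    · rw [Collab.impGlbCov_eq π θ σ P α hQ]
      exact Collab.sandwich_sub_posSemidef (fun i => by
        simpa using (Collab.blockPlus_posDef (π i) hS).posSemidef.conjTranspose_mul_mul_same
          (Collab.imputeMat (π i) S)) hres (hH α hα) hN
    -- At `αᵢ = 1 / cᵢ` the middle weights `αᵢ² cᵢ` are again `1 / cᵢ`, so the sandwich is `N⁻¹ N
    -- N⁻¹ = N⁻¹`.
    · have hc : ∀ i, (Collab.residualVar (π i) S σ θ)⁻¹ ^ 2 * Collab.residualVar (π i) S σ θ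
          = (Collab.residualVar (π i) S σ θ)⁻¹ := fun i => by
        have := (hres i).ne'
        field_simp
      simp only [Collab.impGlbCov_eq π θ σ P _ hQ, one_div, smul_smul, hc]
      rw [Matrix.nonsing_inv_mul _ hN.det_pos.ne'.isUnit, Matrix.one_mul]
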